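/- Let $(\mathcal A,\varphi)$ be a non-commutative $C^*$-probability space ($\mathcal A$ a unital $C^*$-algebra, $\varphi:\mathcal A\to\mathbb C$ linear, positive and unital), let $\mathcal H$ be a complex Hilbert space, $V\subseteq\mathcal H$ a set of vectors (for instance $V=\mathcal H$) and $N\ge 1$ an integer. For $f\in V$ let $S_N(f)=[c_{i,j}(f)]_{i,j=1}^N\in M_N(\mathcal A)$ be such that (i) $\varphi(c_{i,j}(f)c_{k,l}(g))=\frac1N\,\delta_{i,l}\,\delta_{j,k}\,\langle f,g\rangle$ for all $f,g\in V$; (ii) $S_N(f)^*=S_N(f)$ for all $f\in V$; (iii) for every set $E\subseteq V$ of pairwise orthogonal non-zero vectors, the real parts $\Re c_{i,j}(f)$ ($i\le j$) and the imaginary parts $\Im c_{i,j}(f)$ ($i<j$), $f\in E$, form a free family, and, for every non-zero $f\in V$, each of these parts is a semicircular element of mean $0$ (a self-adjoint $x$ whose free cumulants are $\kappa_p(x,\dots,x)=\delta_{p,2}\,\sigma^2$, $p\ge1$, for some $\sigma>0$). Write $\mathrm{Tr}$ for the non-normalized trace $\mathrm{Tr}([x_{i,j}])=\sum_i x_{i,i}$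 (so $\mathrm{Tr}(X)\in\mathcal A$ for $X\in M_N(\mathcal A)$). Write $\mathrm{tr}=\frac1N\mathrm{Tr}$ on $M_N(\mathbb C)$, and on $M_N(\mathcal A)$ let $\mathrm{tr}$ denote the scalar-valued functional $\mathrm{tr}(X)=\frac1N\varphi(\mathrm{Tr}(X))$. Let $\{f_i\}_{i\in I}\subseteq V$ be an orthonormal family and let $n,m\ge 1$. Let $s_1,\dots,s_n,j_1,\dots,j_m\in I$, let $k_1,\dots,k_n,l_1,\dots,l_m$ be positive integers, and put $$P_t=S_N(f_{s_t})^{k_t}-\mathrm{tr}\big(S_N(f_{s_t})^{k_t}\big)I,\qquad Q_t=S_N(f_{j_t})^{l_t}-\mathrm{tr}\big(S_N(f_{j_t})^{l_t}\big)I .$$ Let $A_1,\dots,A_n,B_1,\dots,B_m\in M_N(\mathbb C)$ be constant matrices, each of which is either centered ($\mathrm{tr}=0$) or equal to $I$, such that $A_t\ne I$ whenever $1\le t<n$ and $s_t=s_{t+1}$, and $B_t\neq I$ whenever $1\le t<m$ and $j_t=j_{t+1}$. Then, with $\kappa_2$ the second free cumulant with respect to $\varphi$, $$\kappa_2\big(\mathrm{Tr}(A_nP_n\cdots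 A_1P_1),\ \mathrm{Tr}(Q_1B_1\cdots Q_mB_m)\big)=\delta_{n,m}\prod_{t=1}^n \mathrm{tr}(A_tB_t)\cdot\mathrm{tr}(P_tQ_t).$$ -/

import Mathlib

open scoped ComplexOrder ComplexStarModule

noncomputable section

namespace FreeTrace

/-! ### Free cumulants -/

/-- A partition `π` of `[n]` is non-crossing if there are no two distinct blocks `B`, `D` and
`i < j < k < l` with `i, k ∈ B` and `j, l ∈ D`. -/
def IsNonCrossing {n : ℕ} (π : Finpartition (Finset.univ : Finset (Fin n))) : Prop :=
  ∀ B ∈ π.parts, ∀ D ∈ π.parts, B ≠ D →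
    ¬ ∃ i j k l : Fin n, i < j ∧ j < k ∧ k < l ∧ i ∈ B ∧ k ∈ B ∧ j ∈ D ∧ l ∈ D

open Classical in
/-- The non-crossing partitions of `[n]` other than the one-block partition `1_n`. -/
def properNC (n : ℕ) : Finset (Finpartition (Finset.univ : Finset (Fin n))) :=
  Finset.univ.filter fun π => IsNonCrossing π ∧ π.parts ≠ {Finset.univ}

theorem card_lt_of_mem_properNC {n : ℕ} {π : Finpartition (Finset.univ : Finset (Fin n))}
    (hπ : π ∈ properNC n) {B : Finset (Fin n)} (hB : B ∈ π.parts) : B.card < n := by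
  have hne : π.parts ≠ {Finset.univ} := by
    simp only [properNC, Finset.mem_filter] at hπ
    exact hπ.2.2
  have hBu : B ≠ Finset.univ := by
    rintro rfl
    refine hne (Finset.eq_singleton_iff_unique_mem.2 ⟨hB, fun C hC => ?_⟩)
    by_contra hCne
    have hd : Disjoint C Finset.univ := π.disjoint hC hB hCne
    obtain ⟨x, hx⟩ := π.nonempty_of_mem_parts hC
    exact Finset.disjoint_left.1 hd hx (Finset.mem_univ x)
  have h := Finset.card_lt_card (Finset.ssubset_univ_iff.2 hBu)
  simpa using h

variable {𝓐 : Type*} [CStarAlgebra 𝓐]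

/-- The free cumulants `κ_n(a_1, …, a_n)` with respect to `φ`: the moment-cumulant formula
`φ(a_1 ⋯ a_n) = ∑_{π ∈ NC(n)} ∏_{B ∈ π} κ_{|B|}(a_b : b ∈ B)`, solved for the term of the
one-block partition. The entries `a_b`, `b ∈ B`, are taken in increasing order of `b`. -/
def freeCumulant (φ : 𝓐 →ₗ[ℂ] ℂ) (n : ℕ) (a : Fin n → 𝓐) : ℂ :=
  φ (List.ofFn a).prod -
    ∑ π : {π // π ∈ properNC n}, ∏ B : {B // B ∈ π.1.parts},
      freeCumulant φ B.1.card (fun i => a (B.1.orderEmbOfFin rfl i))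
termination_by n
decreasing_by exact card_lt_of_mem_properNC π.2 B.2

/-! ### Non-commutative probability -/

/-- `φ` is a positive unital linear functional, that is, `(𝓐, φ)` is a non-commutative
C*-probability space. -/
structure IsState (φ : 𝓐 →ₗ[ℂ] ℂ) : Prop where
  map_one : φ 1 = 1
  nonneg : ∀ a : 𝓐, 0 ≤ φ (star a * a)

/-- A self-adjoint `x` is semicircular of mean `0` (and some variance `σ ^ 2`, `σ > 0`) if
`κ_n(x, …, x) = δ_{n,2} σ ^ 2` for all `n ≥ 1`. -/
def IsCenteredSemicircular (φ : 𝓐 →ₗ[ℂ] ℂ) (x : 𝓐) : Prop :=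
  IsSelfAdjoint x ∧ ∃ σ : ℝ, 0 < σ ∧
    ∀ n : ℕ, 0 < n → freeCumulant φ n (fun _ => x) = if n = 2 then ((σ ^ 2 : ℝ) : ℂ) else 0

/-- Free independence of a family of unital subalgebras. -/
def FreeSubalgebras (φ : 𝓐 →ₗ[ℂ] ℂ) {ι : Type*} (𝓑 : ι → Subalgebra ℂ 𝓐) : Prop :=
  ∀ (n : ℕ), 0 < n → ∀ (ε : Fin n → ι) (a : Fin n → 𝓐),
    (∀ i, a i ∈ 𝓑 (ε i)) → (∀ i, φ (a i) = 0) →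
    (∀ (i : ℕ) (h : i + 1 < n), ε ⟨i, by omega⟩ ≠ ε ⟨i + 1, h⟩) →
    φ (List.ofFn a).prod = 0

/-- A family of self-adjoint elements is free if the unital subalgebras generated by its
members are free. -/
def FreeFamily (φ : 𝓐 →ₗ[ℂ] ℂ) {ι : Type*} (x : ι → 𝓐) : Prop :=
  FreeSubalgebras φ fun i => Algebra.adjoin ℂ {x i}

/-! ### Random matrices with entries in `𝓐` -/

variable {N : ℕ}

/-- The constant random matrix given by a complex matrix. -/
def const (𝓐 : Type*) [CStarAlgebra 𝓐] (A : Matrix (Fin N) (Fin N) ℂ) :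
    Matrix (Fin N) (Fin N) 𝓐 :=
  A.map (algebraMap ℂ 𝓐)

/-- The normalized trace `tr` of a complex matrix. -/
def ntr (A : Matrix (Fin N) (Fin N) ℂ) : ℂ := (N : ℂ)⁻¹ * A.trace

/-- The functional `tr ⊗ φ` on random matrices. -/
def ntrState (φ : 𝓐 →ₗ[ℂ] ℂ) (X : Matrix (Fin N) (Fin N) 𝓐) : ℂ := (N : ℂ)⁻¹ * φ X.trace

/-- Labels of the real parts `ℜ c_{i,j}`, `i ≤ j`, and the imaginary parts `ℑ c_{i,j}`, `i < j`,
of the entries of a self-adjoint matrix (the imaginary parts of the diagonal entries vanish). -/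
abbrev EntryIndex (N : ℕ) : Type :=
  {p : Fin N × Fin N // p.1 ≤ p.2} ⊕ {p : Fin N × Fin N // p.1 < p.2}

/-- The real or imaginary part of an entry of `X` with the given label. -/
def entryPart (X : Matrix (Fin N) (Fin N) 𝓐) : EntryIndex N → 𝓐
  | Sum.inl p => ((ℜ (X p.1.1 p.1.2) : selfAdjoint 𝓐) : 𝓐)
  | Sum.inr p => ((ℑ (X p.1.1 p.1.2) : selfAdjoint 𝓐) : 𝓐)

variable {𝓗 : Type*} [NormedAddCommGroup 𝓗] [InnerProductSpace ℂ 𝓗]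

/-- `S(f) = [c_{i,j}(f)]`, `f ∈ V`, are self-adjoint semicircular random matrices of size `N`
over a set `V` of vectors of the Hilbert space `𝓗`. The case `V = 𝓗` is included, and so is
the case where only the vectors of a real form of `𝓗`, or of one orthogonal system, are used. -/
structure IsSemicircularEnsemble (φ : 𝓐 →ₗ[ℂ] ℂ) (V : Set 𝓗)
    (S : 𝓗 → Matrix (Fin N) (Fin N) 𝓐) : Prop where
  /-- `φ(c_{i,j}(f) c_{k,l}(g)) = N⁻¹ δ_{i,l} δ_{j,k} ⟨f, g⟩`. -/
  covariance : ∀ f ∈ V, ∀ g ∈ V, ∀ i j k l : Fin N,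
    φ (S f i j * S g k l) = if i = l ∧ j = k then (N : ℂ)⁻¹ * inner ℂ f g else 0
  /-- `S(f)* = S(f)`. -/
  selfAdjoint : ∀ f ∈ V, (S f).conjTranspose = S f
  /-- The real and imaginary parts of the entries are semicircular of mean `0`. -/
  semicircular : ∀ f ∈ V, f ≠ 0 → ∀ e : EntryIndex N, IsCenteredSemicircular φ (entryPart (S f) e)
  /-- The real and imaginary parts of the entries are free, jointly over pairwise orthogonal
  vectors. -/
  free : ∀ E : Set 𝓗, E ⊆ V → 0 ∉ E → E.Pairwise (fun f g => inner ℂ f g = 0) →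
    FreeFamily φ fun p : E × EntryIndex N => entryPart (S p.1.1) p.2

/-- `S(f) ^ k - tr(S(f) ^ k) I`, where the scalar is the value of `tr ⊗ φ`. -/
def centeredPower (φ : 𝓐 →ₗ[ℂ] ℂ) (X : Matrix (Fin N) (Fin N) 𝓐) (k : ℕ) :
    Matrix (Fin N) (Fin N) 𝓐 :=
  X ^ k - ntrState φ (X ^ k) • (1 : Matrix (Fin N) (Fin N) 𝓐)

end FreeTrace

end

noncomputable section

namespace FreeTrace

/-! ### Non-crossing pairings -/

/-! The proof is an orthogonality argument for Wick products. The functional φ need not be tracial,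
and no genus expansion of matrix moments is needed.

For scalars, `wick` orthogonalises words by subtracting the contraction of neighbouring letters. In
free semicircular letters it becomes an alternating product of Chebyshev polynomials of positive
degree, each of them centered, so freeness makes it centered (`map_wick_eq_zero_of_free`). The
entries of the S(f_i) are linear combinations of such letters, and `wick` is multilinear, so Wick
words in the entries are centered too. Moving letters across the product one at a time then gives
φ(W(u)* W(v)) as the letter-by-letter product of covariances, and zero for different lengths
(`map_star_wick_mul_wick`).

For matrices, summing Wick words over indices gives a Wick product of T_{i₁} C₁ T_{i₂} C₂ ⋯, in
which contracting two adjacent equal colours produces the scalar tr(C) of the matrix between them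
(`matrixWick_cons_cons`). Hence a run with C = I builds a Chebyshev polynomial in T_i, and a
centered C or a change of colour stops contraction: the admissible products U(T_{i₁}) B₁ U(T_{i₂})
B₂ ⋯ are themselves Wick products. Their traces have covariance ∏ tr(Cₜ* Dₜ) over letters, which
regroups into blocks (`pairing_flatMap_blockLetters`).

A centered power of S(f_i) lies in the span of the Chebyshev polynomials of positive degree, so
multilinearity passes from these to the Pₜ and Qₜ. Taking adjoints turns Tr(A_n P_n ⋯ A_1 P_1) into
the trace of P_1 A_1* ⋯ P_n A_n*, which has the order of the second argument; the cumulant is then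
exactly such a covariance, the means being zero. -/

/-- `p` is the set of blocks of a non-crossing pairing of `s`. -/
def IsNCPairing {α : Type*} [LinearOrder α] (s : Finset α) (p : Finset (Finset α)) : Prop :=
  (∀ B ∈ p, B.card = 2 ∧ B ⊆ s) ∧ (∀ x ∈ s, ∃ B ∈ p, x ∈ B) ∧
    (∀ B ∈ p, ∀ D ∈ p, B ≠ D → Disjoint B D) ∧
    ∀ B ∈ p, ∀ D ∈ p, B ≠ D →
      ¬ ∃ i j k l : α, i < j ∧ j < k ∧ k < l ∧ i ∈ B ∧ k ∈ B ∧ j ∈ D ∧ l ∈ D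

open Classical in
/-- The non-crossing pairings of `s`. -/
def ncPairings {α : Type*} [LinearOrder α] (s : Finset α) : Finset (Finset (Finset α)) :=
  s.powerset.powerset.filter (IsNCPairing s)

theorem mem_ncPairings {α : Type*} [LinearOrder α] {s : Finset α} {p : Finset (Finset α)} :
    p ∈ ncPairings s ↔ IsNCPairing s p := by
  classical
  rw [ncPairings, Finset.mem_filter, and_iff_right_iff_imp]
  intro h
  rw [Finset.mem_powerset]
  intro B hB
  exact Finset.mem_powerset.2 (h.1 B hB).2

/-- The weighted number of non-crossing pairings of `s`. -/
def ncWeight {α : Type*} [LinearOrder α] (c : ℂ) (s : Finset α) : ℂ :=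
  ∑ p ∈ ncPairings s, c ^ p.card

/-- Crossings depend only on the relative order of the points. This lets intervals and `Fin n` all
be compared with an initial segment of ℕ. -/
theorem isNCPairing_map {α β : Type*} [LinearOrder α] [LinearOrder β] (e : α ↪o β)
    (s : Finset α) (p : Finset (Finset α)) :
    IsNCPairing (s.map e.toEmbedding) (p.map (Finset.mapEmbedding e.toEmbedding).toEmbedding) ↔
      IsNCPairing s p := by
  have hall : ∀ Q : Finset β → Prop,
      (∀ B ∈ p.map (Finset.mapEmbedding e.toEmbedding).toEmbedding, Q B) ↔
        ∀ B ∈ p, Q (B.map e.toEmbedding) := fun Q => by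
    simp only [Finset.forall_mem_map, RelEmbedding.coe_toEmbedding, Finset.mapEmbedding_apply]
  simp only [IsNCPairing, hall]
  refine and_congr ?_ (and_congr ?_ (and_congr ?_ ?_))
  · simp
  · simp
  · simp
  · refine forall₂_congr fun B hB => forall₂_congr fun D hD => imp_congr (by simp) (not_congr ?_)
    constructor
    · rintro ⟨i, j, k, l, hij, hjk, hkl, hi, hk, hj, hl⟩
      rw [Finset.mem_map] at hi hj hk hl
      obtain ⟨i, hi, rfl⟩ := hi
      obtain ⟨j, hj, rfl⟩ := hj
      obtain ⟨k, hk, rfl⟩ := hk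
      obtain ⟨l, hl, rfl⟩ := hl
      exact ⟨i, j, k, l, e.lt_iff_lt.1 hij, e.lt_iff_lt.1 hjk, e.lt_iff_lt.1 hkl, hi, hk, hj, hl⟩
    · rintro ⟨i, j, k, l, hij, hjk, hkl, hi, hk, hj, hl⟩
      exact ⟨e i, e j, e k, e l, e.lt_iff_lt.2 hij, e.lt_iff_lt.2 hjk, e.lt_iff_lt.2 hkl,
        by simpa, by simpa, by simpa, by simpa⟩

theorem ncWeight_map {α β : Type*} [LinearOrder α] [LinearOrder β] (e : α ↪o β) (c : ℂ)
    (s : Finset α) : ncWeight c (s.map e.toEmbedding) = ncWeight c s := by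
  classical
  symm
  refine Finset.sum_bij (fun p _ => p.map (Finset.mapEmbedding e.toEmbedding).toEmbedding)
    (fun p hp => ?_) (fun p _ q _ h => Finset.map_injective _ h) (fun p hp => ?_)
    (fun p _ => by rw [Finset.card_map])
  · rw [mem_ncPairings] at hp ⊢
    exact (isNCPairing_map e s p).2 hp
  · rw [mem_ncPairings] at hp
    have hsub : ∀ B ∈ p, ∃ B' : Finset α, B'.map e.toEmbedding = B := by
      intro B hB
      obtain ⟨u, -, hu⟩ := Finset.subset_map_iff.1 (hp.1 B hB).2
      exact ⟨u, hu.symm⟩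
    have : ∃ q : Finset (Finset α), q.map (Finset.mapEmbedding e.toEmbedding).toEmbedding = p := by
      choose g hg using hsub
      refine ⟨p.attach.image fun B => g B.1 B.2, ?_⟩
      ext B
      simp only [Finset.mem_map, Finset.mem_image, Finset.mem_attach, true_and, Subtype.exists,
        RelEmbedding.coe_toEmbedding, Finset.mapEmbedding_apply]
      constructor
      · rintro ⟨_, ⟨D, hD, rfl⟩, rfl⟩
        rwa [hg]
      · exact fun hB => ⟨_, ⟨B, hB, rfl⟩, hg B hB⟩
    obtain ⟨q, rfl⟩ := this
    exact ⟨q, mem_ncPairings.2 ((isNCPairing_map e s q).1 hp), rfl⟩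

theorem ncWeight_Ico (c : ℂ) (a n : ℕ) :
    ncWeight c (Finset.Ico a (a + n)) = ncWeight c (Finset.range n) := by
  let e : ℕ ↪o ℕ := 
    OrderEmbedding.ofStrictMono (fun x => a + x) fun x y h => Nat.add_lt_add_left h a
  rw [← ncWeight_map e c (Finset.range n)]
  congr 1
  ext x
  simp only [Finset.mem_Ico, Finset.mem_map, Finset.mem_range]
  constructor
  · intro h
    exact ⟨x - a, by omega, show a + (x - a) = x by omega⟩
  · rintro ⟨y, hy, hyx⟩
    change a + y = x at hyx
    omega

theorem ncWeight_univ_fin (c : ℂ) (n : ℕ) :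
    ncWeight c (Finset.univ : Finset (Fin n)) = ncWeight c (Finset.range n) := by
  let e : Fin n ↪o ℕ := OrderEmbedding.ofStrictMono Fin.val fun x y h => h
  rw [← ncWeight_map e c Finset.univ]
  congr 1
  ext x
  simp only [Finset.mem_map, Finset.mem_univ, true_and, Finset.mem_range]
  constructor
  · rintro ⟨y, rfl⟩
    exact y.2
  · exact fun h => ⟨⟨x, h⟩, rfl⟩

theorem ncWeight_range_zero (c : ℂ) : ncWeight c (Finset.range 0) = 1 := by
  have : ncPairings (Finset.range 0) = {∅} := by
    ext p
    rw [mem_ncPairings, Finset.mem_singleton]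
    constructor
    · intro h
      refine Finset.eq_empty_of_forall_notMem fun B hB => ?_
      obtain ⟨h1, h2⟩ := h.1 B hB
      simp only [Finset.range_zero, Finset.subset_empty] at h2
      simp [h2] at h1
    · rintro rfl
      simp [IsNCPairing]
  rw [ncWeight, this]
  simp

theorem ncWeight_range_one (c : ℂ) : ncWeight c (Finset.range 1) = 0 := by
  have : ncPairings (Finset.range 1) = ∅ := by
    refine Finset.eq_empty_of_forall_notMem fun p hp => ?_
    rw [mem_ncPairings] at hp
    obtain ⟨B, hB, -⟩ := hp.2.1 0 (by simp)
    obtain ⟨h1, h2⟩ := hp.1 B hB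
    have := Finset.card_le_card h2
    simp at this
    omega
  rw [ncWeight, this, Finset.sum_empty]

/-- Gluing non-crossing pairings of the inside and of the outside of the block of `0`. -/
theorem IsNCPairing.glue {n k : ℕ} (hk : k ≤ n) {p q : Finset (Finset ℕ)}
    (hp : IsNCPairing (Finset.Ico 1 (1 + k)) p)
    (hq : IsNCPairing (Finset.Ico (k + 2) (k + 2 + (n - k))) q) :
    IsNCPairing (Finset.range (n + 2)) (insert {0, k + 1} (p ∪ q)) := by
  have hp1 : ∀ B ∈ p, ∀ x ∈ B, 1 ≤ x ∧ x < 1 + k := fun B hB x hx =>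
    Finset.mem_Ico.1 ((hp.1 B hB).2 hx)
  have hq1 : ∀ B ∈ q, ∀ x ∈ B, k + 2 ≤ x ∧ x < n + 2 := fun B hB x hx => by
    have := Finset.mem_Ico.1 ((hq.1 B hB).2 hx)
    omega
  have h0 : ∀ x ∈ ({0, k + 1} : Finset ℕ), x = 0 ∨ x = k + 1 := by simp
  refine ⟨?_, ?_, ?_, ?_⟩
  · intro B hB
    simp only [Finset.mem_insert, Finset.mem_union] at hB
    rcases hB with rfl | hB | hB
    · refine ⟨Finset.card_pair (by omega), fun x hx => ?_⟩
      have := h0 x hx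
      rw [Finset.mem_range]
      omega
    · refine ⟨(hp.1 B hB).1, fun x hx => ?_⟩
      have := hp1 B hB x hx
      rw [Finset.mem_range]
      omega
    · refine ⟨(hq.1 B hB).1, fun x hx => ?_⟩
      have := hq1 B hB x hx
      rw [Finset.mem_range]
      omega
  · intro x hx
    rw [Finset.mem_range] at hx
    by_cases h : x = 0 ∨ x = k + 1
    · exact ⟨_, Finset.mem_insert_self _ _, by simpa using h⟩
    by_cases h' : x < 1 + k
    · obtain ⟨B, hB, hxB⟩ := hp.2.1 x (Finset.mem_Ico.2 (by omega))
      exact ⟨B, by simp [hB], hxB⟩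
    · obtain ⟨B, hB, hxB⟩ := hq.2.1 x (Finset.mem_Ico.2 (by omega))
      exact ⟨B, by simp [hB], hxB⟩
  · intro B hB D hD hne
    rw [Finset.disjoint_left]
    intro x hxB hxD
    simp only [Finset.mem_insert, Finset.mem_union] at hB hD
    rcases hB with rfl | hB | hB <;> rcases hD with rfl | hD | hD
    · exact hne rfl
    · have := h0 x hxB; have := hp1 D hD x hxD; omega
    · have := h0 x hxB; have := hq1 D hD x hxD; omega
    · have := h0 x hxD; have := hp1 B hB x hxB; omega
    · exact Finset.disjoint_left.1 (hp.2.2.1 B hB D hD hne) hxB hxD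
    · have := hp1 B hB x hxB; have := hq1 D hD x hxD; omega
    · have := h0 x hxD; have := hq1 B hB x hxB; omega
    · have := hq1 B hB x hxB; have := hp1 D hD x hxD; omega
    · exact Finset.disjoint_left.1 (hq.2.2.1 B hB D hD hne) hxB hxD
  · rintro B hB D hD hne ⟨i, j, l, m, hij, hjl, hlm, hi, hl, hj, hm⟩
    simp only [Finset.mem_insert, Finset.mem_union] at hB hD
    rcases hB with rfl | hB | hB <;> rcases hD with rfl | hD | hD
    · exact hne rfl
    · have := h0 l hl; have := hp1 D hD m hm; omega
    · have := h0 l hl; have := hq1 D hD j hj; omega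
    · have := h0 j hj; have := hp1 B hB l hl; omega
    · exact hp.2.2.2 B hB D hD hne ⟨i, j, l, m, hij, hjl, hlm, hi, hl, hj, hm⟩
    · have := hp1 B hB l hl; have := hq1 D hD j hj; omega
    · have := h0 j hj; have := hq1 B hB i hi; omega
    · have := hq1 B hB i hi; have := hp1 D hD j hj; omega
    · exact hq.2.2.2 B hB D hD hne ⟨i, j, l, m, hij, hjl, hlm, hi, hl, hj, hm⟩

theorem IsNCPairing.filter_mem {s t : Finset ℕ} {p : Finset (Finset ℕ)} (hp : IsNCPairing s p)
    (ht : ∀ x ∈ t, ∃ B ∈ p, x ∈ B ∧ B ⊆ t) :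
    IsNCPairing t (p.filter (· ⊆ t)) := by
  refine ⟨?_, ?_, ?_, ?_⟩
  · intro B hB
    rw [Finset.mem_filter] at hB
    exact ⟨(hp.1 B hB.1).1, hB.2⟩
  · intro x hx
    obtain ⟨B, hB, hxB, hBt⟩ := ht x hx
    exact ⟨B, Finset.mem_filter.2 ⟨hB, hBt⟩, hxB⟩
  · exact fun B hB D hD => hp.2.2.1 B (Finset.mem_filter.1 hB).1 D (Finset.mem_filter.1 hD).1
  · exact fun B hB D hD => hp.2.2.2 B (Finset.mem_filter.1 hB).1 D (Finset.mem_filter.1 hD).1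

/-- The block {0, k + 1} separates the remaining points: a block with one point on each side would
cross it. The two sides therefore carry independent pairings. -/
theorem IsNCPairing.exists_glue {n : ℕ} {r : Finset (Finset ℕ)}
    (hr : IsNCPairing (Finset.range (n + 2)) r) :
    ∃ k ≤ n, ∃ p q, IsNCPairing (Finset.Ico 1 (1 + k)) p ∧
      IsNCPairing (Finset.Ico (k + 2) (k + 2 + (n - k))) q ∧ insert {0, k + 1} (p ∪ q) = r := by
  obtain ⟨B, hB, h0⟩ := hr.2.1 0 (by simp)
  obtain ⟨hBc, hBs⟩ := hr.1 B hB
  obtain ⟨k, hk, rfl⟩ : ∃ k ≤ n, B = {0, k + 1} := by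
    obtain ⟨x, y, hxy, rfl⟩ := Finset.card_eq_two.1 hBc
    have hx := hBs (Finset.mem_insert_self _ _)
    have hy := hBs (Finset.mem_insert_of_mem (Finset.mem_singleton_self _))
    simp only [Finset.mem_range] at hx hy
    simp only [Finset.mem_insert, Finset.mem_singleton] at h0
    rcases h0 with rfl | rfl
    · exact ⟨y - 1, by omega, by rw [show y - 1 + 1 = y by omega]⟩
    · exact ⟨x - 1, by omega, by rw [show x - 1 + 1 = x by omega, Finset.pair_comm]⟩
  have key : ∀ D ∈ r, D ≠ {0, k + 1} →
      D ⊆ Finset.Ico 1 (1 + k) ∨ D ⊆ Finset.Ico (k + 2) (k + 2 + (n - k)) := by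
    intro D hD hne
    obtain ⟨hDc, hDs⟩ := hr.1 D hD
    have hd := hr.2.2.1 D hD _ hB hne
    obtain ⟨x, y, hxy, rfl⟩ : ∃ x y, x < y ∧ D = {x, y} := by
      obtain ⟨x, y, hxy, rfl⟩ := Finset.card_eq_two.1 hDc
      rcases lt_or_gt_of_ne hxy with h | h
      · exact ⟨x, y, h, rfl⟩
      · exact ⟨y, x, h, Finset.pair_comm _ _⟩
    have hnc : ¬ (x < k + 1 ∧ k + 1 < y ∧ 0 < x) := fun h =>
      hr.2.2.2 _ hB _ hD hne.symm ⟨0, x, k + 1, y, h.2.2, h.1, h.2.1, by simp, by simp, by simp,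
        by simp⟩
    simp only [Finset.disjoint_insert_left, Finset.disjoint_singleton_left, Finset.mem_insert,
      Finset.mem_singleton, not_or] at hd
    simp only [Finset.insert_subset_iff, Finset.singleton_subset_iff, Finset.mem_range,
      Finset.mem_Ico] at hDs ⊢
    omega
  have cover : ∀ x, x < n + 2 → x ≠ 0 → x ≠ k + 1 → ∃ D ∈ r, x ∈ D ∧ D ≠ {0, k + 1} := by
    intro x hx h0 h1
    obtain ⟨D, hD, hxD⟩ := hr.2.1 x (Finset.mem_range.2 hx)
    refine ⟨D, hD, hxD, ?_⟩
    rintro rfl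
    simp at hxD
    omega
  refine ⟨k, hk, r.filter (· ⊆ Finset.Ico 1 (1 + k)),
    r.filter (· ⊆ Finset.Ico (k + 2) (k + 2 + (n - k))), hr.filter_mem ?_, hr.filter_mem ?_, ?_⟩
  · intro x hx
    rw [Finset.mem_Ico] at hx
    obtain ⟨D, hD, hxD, hne⟩ := cover x (by omega) (by omega) (by omega)
    refine ⟨D, hD, hxD, (key D hD hne).resolve_right fun h => ?_⟩
    have := Finset.mem_Ico.1 (h hxD)
    omega
  · intro x hx
    rw [Finset.mem_Ico] at hx
    obtain ⟨D, hD, hxD, hne⟩ := cover x (by omega) (by omega) (by omega)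
    refine ⟨D, hD, hxD, (key D hD hne).resolve_left fun h => ?_⟩
    have := Finset.mem_Ico.1 (h hxD)
    omega
  · ext D
    simp only [Finset.mem_insert, Finset.mem_union, Finset.mem_filter]
    constructor
    · rintro (rfl | h | h)
      exacts [hB, h.1, h.1]
    · intro hD
      by_cases h : D = {0, k + 1}
      · exact Or.inl h
      · exact Or.inr ((key D hD h).imp (fun h => ⟨hD, h⟩) fun h => ⟨hD, h⟩)

/-- Both pieces can be recovered from the glued pairing, which is what makes gluing injective. -/
theorem filter_glue {k n : ℕ} {p q : Finset (Finset ℕ)}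
    (hp : IsNCPairing (Finset.Ico 1 (1 + k)) p)
    (hq : IsNCPairing (Finset.Ico (k + 2) (k + 2 + (n - k))) q) :
    (insert {0, k + 1} (p ∪ q)).filter (· ⊆ Finset.Ico 1 (1 + k)) = p ∧
    (insert {0, k + 1} (p ∪ q)).filter (· ⊆ Finset.Ico (k + 2) (k + 2 + (n - k))) = q := by
  have hne : ∀ {s r B}, IsNCPairing s r → B ∈ r → ∃ x : ℕ, x ∈ B := by
    intro s r B hr hB
    obtain ⟨x, y, -, rfl⟩ := Finset.card_eq_two.1 (hr.1 B hB).1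
    exact ⟨x, by simp⟩
  constructor <;> ext B <;>
    simp only [Finset.mem_insert, Finset.mem_union, Finset.mem_filter]
  · refine ⟨?_, fun h => ⟨Or.inr (Or.inl h), (hp.1 B h).2⟩⟩
    rintro ⟨rfl | h | h, hs⟩
    · simp [Finset.insert_subset_iff] at hs
    · exact h
    · obtain ⟨x, hx⟩ := hne hq h
      have h1 := Finset.mem_Ico.1 (hs hx)
      have h2 := Finset.mem_Ico.1 ((hq.1 B h).2 hx)
      omega
  · refine ⟨?_, fun h => ⟨Or.inr (Or.inr h), (hq.1 B h).2⟩⟩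
    rintro ⟨rfl | h | h, hs⟩
    · simp [Finset.insert_subset_iff] at hs
    · obtain ⟨x, hx⟩ := hne hp h
      have h1 := Finset.mem_Ico.1 (hs hx)
      have h2 := Finset.mem_Ico.1 ((hp.1 B h).2 hx)
      omega
    · exact h

theorem card_glue {k n : ℕ} {p q : Finset (Finset ℕ)}
    (hp : IsNCPairing (Finset.Ico 1 (1 + k)) p)
    (hq : IsNCPairing (Finset.Ico (k + 2) (k + 2 + (n - k))) q) :
    (insert {0, k + 1} (p ∪ q)).card = p.card + q.card + 1 := by
  have h0 : ({0, k + 1} : Finset ℕ) ∉ p ∪ q := by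
    intro h
    rcases Finset.mem_union.1 h with h | h
    · have := Finset.mem_Ico.1 ((hp.1 _ h).2 (Finset.mem_insert_self _ _))
      omega
    · have := Finset.mem_Ico.1 ((hq.1 _ h).2 (Finset.mem_insert_self _ _))
      omega
  rw [Finset.card_insert_of_notMem h0, Finset.card_union_of_disjoint]
  rw [Finset.disjoint_left]
  intro B h h'
  obtain ⟨x, y, -, rfl⟩ := Finset.card_eq_two.1 (hp.1 B h).1
  have h1 := Finset.mem_Ico.1 ((hp.1 _ h).2 (Finset.mem_insert_self _ _))
  have h2 := Finset.mem_Ico.1 ((hq.1 _ h').2 (Finset.mem_insert_self _ _))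
  omega

/-- The weighted Catalan recursion, obtained by conditioning on the partner k + 1 of 0; the factor
`c` is the weight of that block. -/
theorem ncWeight_range_add_two (c : ℂ) (n : ℕ) :
    ncWeight c (Finset.range (n + 2)) =
      c * ∑ k ∈ Finset.range (n + 1),
        ncWeight c (Finset.range k) * ncWeight c (Finset.range (n - k)) := by
  have h1 : ∀ k ∈ Finset.range (n + 1),
      ncWeight c (Finset.range k) * ncWeight c (Finset.range (n - k)) =
      ∑ x ∈ ncPairings (Finset.Ico 1 (1 + k)) ×ˢ
        ncPairings (Finset.Ico (k + 2) (k + 2 + (n - k))), c ^ x.1.card * c ^ x.2.card := by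
    intro k _
    rw [← ncWeight_Ico c 1 k, ← ncWeight_Ico c (k + 2) (n - k), Finset.sum_product, ncWeight,
      ncWeight, Finset.sum_mul_sum]
  rw [Finset.sum_congr rfl h1, Finset.sum_sigma', Finset.mul_sum]
  symm
  refine Finset.sum_bij (fun x _ => insert {0, x.1 + 1} (x.2.1 ∪ x.2.2)) ?_ ?_ ?_ ?_
  · rintro ⟨k, p, q⟩ hx
    simp only [Finset.mem_sigma, Finset.mem_range, Finset.mem_product, mem_ncPairings] at hx ⊢
    exact hx.2.1.glue (by omega) hx.2.2
  · rintro ⟨k, p, q⟩ hx ⟨k', p', q'⟩ hx' h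
    simp only [Finset.mem_sigma, Finset.mem_range, Finset.mem_product, mem_ncPairings] at hx hx' h
    have hk : k = k' := by
      have hm : ({0, k + 1} : Finset ℕ) ∈ insert {0, k' + 1} (p' ∪ q') :=
        h ▸ Finset.mem_insert_self _ _
      simp only [Finset.mem_insert, Finset.mem_union] at hm
      rcases hm with hm | hm | hm
      · have : k + 1 ∈ ({0, k' + 1} : Finset ℕ) := hm ▸ by simp
        simpa using this
      · have := Finset.mem_Ico.1 ((hx'.2.1.1 _ hm).2 (Finset.mem_insert_self _ _))
        omega
      · have := Finset.mem_Ico.1 ((hx'.2.2.1 _ hm).2 (Finset.mem_insert_self _ _))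
        omega
    subst hk
    obtain ⟨a, b⟩ := filter_glue hx.2.1 hx.2.2
    obtain ⟨a', b'⟩ := filter_glue hx'.2.1 hx'.2.2
    rw [h] at a b
    rw [← a, ← b, a', b']
  · intro r hr
    obtain ⟨k, hk, p, q, hp, hq, rfl⟩ := (mem_ncPairings.1 hr).exists_glue
    refine ⟨⟨k, p, q⟩, ?_, rfl⟩
    simp only [Finset.mem_sigma, Finset.mem_range, Finset.mem_product, mem_ncPairings]
    exact ⟨by omega, hp, hq⟩
  · rintro ⟨k, p, q⟩ hx
    simp only [Finset.mem_sigma, Finset.mem_range, Finset.mem_product, mem_ncPairings] at hx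
    rw [card_glue hx.2.1 hx.2.2]
    ring

end FreeTrace

namespace FreeTrace

/-! ### Moments of semicircular elements -/

-- Only partitions with all blocks of size two survive in the product, and those are the pairings.
open Classical in
theorem sum_properNC_eq (s : ℂ) (n : ℕ) :
    ∑ π ∈ properNC n, ∏ B ∈ π.parts, (if B.card = 2 then s else 0) =
      ∑ p ∈ (ncPairings (Finset.univ : Finset (Fin n))).filter (· ≠ {Finset.univ}),
        s ^ p.card := by
  simp only [Finset.prod_ite_zero, Finset.prod_const]
  rw [← Finset.sum_filter]
  refine Finset.sum_bij (fun π _ => π.parts) (fun π hπ => ?_)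
    (fun π _ ρ _ h => Finpartition.ext h) (fun p hp => ?_) (fun _ _ => rfl)
  · simp only [properNC, Finset.mem_filter, Finset.mem_univ, true_and, mem_ncPairings] at hπ ⊢
    obtain ⟨⟨h1, h2⟩, h3⟩ := hπ
    refine ⟨⟨fun B hB => ⟨h3 B hB, Finset.subset_univ _⟩, fun x _ => ?_,
      fun B hB D hD hne => π.disjoint hB hD hne, h1⟩, h2⟩
    obtain ⟨B, hB, -⟩ := π.existsUnique_mem (Finset.mem_univ x)
    exact ⟨B, hB⟩
  · simp only [properNC, Finset.mem_filter, Finset.mem_univ, true_and, mem_ncPairings] at hp ⊢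
    obtain ⟨⟨h1, h2, h3, h4⟩, h5⟩ := hp
    refine ⟨Finpartition.ofExistsUnique p (fun B hB => (h1 B hB).2) (fun x hx => ?_) (fun h0 => ?_),
      ⟨⟨h4, h5⟩, fun B hB => (h1 B hB).1⟩, rfl⟩
    · obtain ⟨B, hB, hxB⟩ := h2 x hx
      refine ⟨B, ⟨hB, hxB⟩, fun D hD => ?_⟩
      by_contra hne
      exact Finset.disjoint_left.1 (h3 D hD.1 B hB hne) hD.2 hxB
    · simpa using (h1 ∅ h0).1

variable {𝓐 : Type*} [CStarAlgebra 𝓐]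

theorem freeCumulant_const (φ : 𝓐 →ₗ[ℂ] ℂ) (x : 𝓐) (n : ℕ) :
    freeCumulant φ n (fun _ => x) = φ (x ^ n) - ∑ π ∈ properNC n, ∏ B ∈ π.parts,
      freeCumulant φ B.card (fun _ => x) := by
  rw [freeCumulant, List.ofFn_const, List.prod_replicate]
  congr 1
  rw [← Finset.sum_coe_sort (properNC n)]
  refine Finset.sum_congr rfl fun π _ => ?_
  rw [← Finset.prod_coe_sort π.1.parts]

/-- In the moment-cumulant formula the one-block partition is split off as κ_n, and it is a pairing
exactly when n = 2; adding it back completes the sum over all pairings. -/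
theorem map_pow_eq_ncWeight {φ : 𝓐 →ₗ[ℂ] ℂ} (hφ : φ 1 = 1) {x : 𝓐} {s : ℂ}
    (hx : ∀ n : ℕ, 0 < n → freeCumulant φ n (fun _ => x) = if n = 2 then s else 0) (n : ℕ) :
    φ (x ^ n) = ncWeight s (Finset.range n) := by
  classical
  rcases Nat.eq_zero_or_pos n with rfl | hn
  · rw [pow_zero, hφ, ncWeight_range_zero]
  have h := freeCumulant_const φ x n
  have h2 : ∑ π ∈ properNC n, ∏ B ∈ π.parts, freeCumulant φ B.card (fun _ => x) =
      ∑ π ∈ properNC n, ∏ B ∈ π.parts, (if B.card = 2 then s else 0) :=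
    Finset.sum_congr rfl fun π _ => Finset.prod_congr rfl fun B hB =>
      hx _ (Finset.card_pos.2 (π.nonempty_of_mem_parts hB))
  rw [h2, sum_properNC_eq, hx n hn] at h
  rw [← ncWeight_univ_fin, ncWeight, ← Finset.sum_filter_add_sum_filter_not _ (· ≠ {Finset.univ}),
    sub_eq_iff_eq_add'.1 h.symm]
  congr 1
  simp only [not_not, Finset.filter_eq', mem_ncPairings]
  have hiff : IsNCPairing (Finset.univ : Finset (Fin n)) {Finset.univ} ↔ n = 2 := by
    simp [IsNCPairing]
  rw [hiff]
  split_ifs <;> simp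

theorem map_pow_recursion {φ : 𝓐 →ₗ[ℂ] ℂ} (hφ : φ 1 = 1) {x : 𝓐} {s : ℂ}
    (hx : ∀ n : ℕ, 0 < n → freeCumulant φ n (fun _ => x) = if n = 2 then s else 0) (n : ℕ) :
    φ (x ^ (n + 2)) = s * ∑ k ∈ Finset.range (n + 1), φ (x ^ k) * φ (x ^ (n - k)) := by
  simp only [map_pow_eq_ncWeight hφ hx, ncWeight_range_add_two]

/-! ### Chebyshev polynomials -/

/-- The monic Chebyshev polynomials of the second kind, orthogonal for the semicircle law of
variance `s`, evaluated at `x`. -/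
def cheb {R : Type*} [Ring R] [Algebra ℂ R] (s : ℂ) (x : R) : ℕ → R
  | 0 => 1
  | 1 => x
  | k + 2 => x * cheb s x (k + 1) - s • cheb s x k

section Cheb

variable {R : Type*} [Ring R] [Algebra ℂ R]

theorem map_cheb {R' : Type*} [Ring R'] [Algebra ℂ R'] (F : R →ₐ[ℂ] R') (s : ℂ) (x : R) :
    ∀ k, F (cheb s x k) = cheb s (F x) k
  | 0 => map_one F
  | 1 => rfl
  | k + 2 => by simp only [cheb, map_sub, map_mul, map_smul, map_cheb F s x]

theorem cheb_mem_adjoin (s : ℂ) (x : R) : ∀ k, cheb s x k ∈ Algebra.adjoin ℂ {x}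
  | 0 => one_mem _
  | 1 => Algebra.subset_adjoin rfl
  | k + 2 => sub_mem (mul_mem (Algebra.subset_adjoin rfl) (cheb_mem_adjoin s x (k + 1)))
      (Subalgebra.smul_mem _ (cheb_mem_adjoin s x k) s)

theorem mul_cheb_succ (s : ℂ) (x : R) (k : ℕ) :
    x * cheb s x (k + 1) = cheb s x (k + 2) + s • cheb s x k := by
  simp only [cheb, sub_add_cancel]

/-- `x ^ k` is a multiple of `1` up to the Chebyshev polynomials of positive degree. -/
theorem exists_pow_sub_mem_span_cheb (s : ℂ) (x : R) (k : ℕ) :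
    ∃ c : ℂ, x ^ k - c • (1 : R) ∈
      Submodule.span ℂ (Set.range fun r : ℕ => cheb s x (r + 1)) := by
  set M := Submodule.span ℂ (Set.range fun r : ℕ => cheb s x (r + 1))
  have hmem : ∀ r, cheb s x (r + 1) ∈ M := fun r => Submodule.subset_span ⟨r, rfl⟩
  -- Multiplication by `x` preserves the span up to a scalar; the scalar arises only from x · U₁ =
  -- U₂ + s · 1.
  have hmul : ∀ y ∈ M, ∃ c : ℂ, x * y - c • (1 : R) ∈ M := by
    intro y hy
    induction hy using Submodule.span_induction with
    | mem y hy =>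
      obtain ⟨r, rfl⟩ := hy
      rcases r with _ | r
      · exact ⟨s, by simpa [mul_cheb_succ, cheb] using hmem 1⟩
      · exact ⟨0, by
          simpa [mul_cheb_succ] using M.add_mem (hmem (r + 2)) (M.smul_mem s (hmem r))⟩
    | zero => exact ⟨0, by simp⟩
    | add y z _ _ hy hz =>
      obtain ⟨a, ha⟩ := hy
      obtain ⟨b, hb⟩ := hz
      refine ⟨a + b, ?_⟩
      have := M.add_mem ha hb
      rw [mul_add, add_smul]
      convert this using 1
      abel
    | smul t y _ hy =>
      obtain ⟨a, ha⟩ := hy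
      refine ⟨t * a, ?_⟩
      have := M.smul_mem t ha
      rwa [smul_sub, ← mul_smul_comm, smul_smul] at this
  induction k with
  | zero => exact ⟨1, by simp⟩
  | succ k ih =>
    obtain ⟨c, hc⟩ := ih
    obtain ⟨d, hd⟩ := hmul _ hc
    refine ⟨d, ?_⟩
    have := M.add_mem hd (M.smul_mem c (hmem 0))
    rw [mul_sub, mul_smul_comm, mul_one, ← pow_succ'] at this
    convert this using 1
    simp only [cheb]
    abel

-- The moment recursion is the Schwinger–Dyson equation L(X p) = s L(D p), where D applies L to one
-- leg of the free difference quotient. Since D lowers Chebyshev polynomials by one degree, the two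
-- terms of the three-term recursion cancel under L.
open Polynomial in
theorem linear_cheb_eq_zero (L : ℂ[X] →ₗ[ℂ] ℂ) (s : ℂ) (h0 : L 1 = 1) (h1 : L X = 0)
    (h2 : ∀ n, L (X ^ (n + 2)) = s * ∑ k ∈ Finset.range (n + 1), L (X ^ k) * L (X ^ (n - k)))
    (k : ℕ) : L (cheb s (X : ℂ[X]) (k + 1)) = 0 := by
  let D : ℂ[X] →ₗ[ℂ] ℂ[X] := (Polynomial.basisMonomials ℂ).constr ℂ fun n =>
    ∑ i ∈ Finset.range n, L (X ^ (n - 1 - i)) • X ^ i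
  have hD : ∀ n : ℕ, D (X ^ n) = ∑ i ∈ Finset.range n, L (X ^ (n - 1 - i)) • X ^ i := by
    intro n
    have := (Polynomial.basisMonomials ℂ).constr_basis ℂ
      (fun n => ∑ i ∈ Finset.range n, L (X ^ (n - 1 - i)) • (X : ℂ[X]) ^ i) n
    rw [Polynomial.coe_basisMonomials] at this
    simp only [Polynomial.monomial_one_right_eq_X_pow] at this
    exact this
  have hD1 : D 1 = 0 := by simpa using hD 0
  have hDX : ∀ p, D (X * p) = L p • 1 + X * D p := by
    intro p
    induction p using Polynomial.induction_on' with
    | add p q hp hq => simp only [mul_add, map_add, hp, hq, add_smul]; abel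
    | monomial n a =>
      rw [← Polynomial.C_mul_X_pow_eq_monomial, ← Polynomial.smul_eq_C_mul, mul_smul_comm,
        ← pow_succ', map_smul, map_smul, map_smul, hD, hD, Finset.sum_range_succ', mul_smul_comm,
        Finset.mul_sum, add_comm, smul_add, smul_eq_mul, mul_smul]
      congr 2
      · refine Finset.sum_congr rfl fun i _ => ?_
        rw [mul_smul_comm, ← pow_succ', show n + 1 - 1 - (i + 1) = n - 1 - i by omega]
  have hLX : ∀ p, L (X * p) = s * L (D p) := by
    intro p
    induction p using Polynomial.induction_on' with
    | add p q hp hq => simp only [mul_add, map_add, hp, hq]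
    | monomial n a =>
      rw [← Polynomial.C_mul_X_pow_eq_monomial, ← Polynomial.smul_eq_C_mul, mul_smul_comm,
        ← pow_succ', map_smul, map_smul, map_smul, hD, smul_eq_mul, smul_eq_mul, mul_left_comm]
      congr 1
      rcases n with _ | n
      · simpa using h1
      · rw [h2, map_sum]
        congr 1
        refine Finset.sum_congr rfl fun i _ => ?_
        rw [map_smul, smul_eq_mul, mul_comm, show n + 1 - 1 - i = n - i by omega]
  -- The two claims feed each other: D U_{k+2} produces the constant L(U_{k+1}), which must vanish,
  -- and L(U_{k+2}) needs D U_{k+1} = U_k. Degrees one and two are separate because U₀ = 1 has L = 1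
  -- and D = 0.
  have key : ∀ k, D (cheb s X (k + 1)) = cheb s X k ∧ L (cheb s (X : ℂ[X]) (k + 1)) = 0 := by
    intro k
    induction k using Nat.strong_induction_on with
    | _ k ih =>
      rcases k with _ | _ | k
      · refine ⟨?_, h1⟩
        have := hDX 1
        rw [mul_one, hD1, h0] at this
        simpa [cheb] using this
      · have hd : D (cheb s X 1) = 1 := (ih 0 (by omega)).1
        have hl : L (cheb s X 1) = 0 := (ih 0 (by omega)).2
        have e : cheb s (X : ℂ[X]) 2 = X * cheb s X 1 - s • 1 := rfl
        constructor
        · rw [e, map_sub, hDX, map_smul, hD1, hd, hl]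
          simp [cheb]
        · rw [e, map_sub, hLX, map_smul, hd, h0]
          simp
      · have hd : D (cheb s X (k + 2)) = cheb s X (k + 1) := (ih (k + 1) (by omega)).1
        have hl : L (cheb s X (k + 2)) = 0 := (ih (k + 1) (by omega)).2
        have hd' : D (cheb s X (k + 1)) = cheb s X k := (ih k (by omega)).1
        have hl' : L (cheb s X (k + 1)) = 0 := (ih k (by omega)).2
        have e : cheb s (X : ℂ[X]) (k + 3) = X * cheb s X (k + 2) - s • cheb s X (k + 1) := rfl
        constructor
        · rw [e, map_sub, hDX, map_smul, hd, hl, hd', zero_smul, zero_add]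
          rfl
        · rw [e, map_sub, hLX, map_smul, hd, hl']
          simp
  exact (key k).2

end Cheb

theorem IsCenteredSemicircular.map_cheb_eq_zero {φ : 𝓐 →ₗ[ℂ] ℂ} (hφ : φ 1 = 1) {x : 𝓐}
    (hx : IsCenteredSemicircular φ x) (k : ℕ) : φ (cheb (φ (x * x)) x (k + 1)) = 0 := by
  obtain ⟨-, σ, -, h⟩ := hx
  have hr := map_pow_recursion hφ h
  have h2 : φ (x * x) = ((σ ^ 2 : ℝ) : ℂ) := by
    simpa [hφ, sq] using hr 0
  have h1 : φ x = 0 := by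
    rw [← pow_one x, map_pow_eq_ncWeight hφ h 1, ncWeight_range_one]
  have := linear_cheb_eq_zero (φ ∘ₗ (Polynomial.aeval x).toLinearMap) ((σ ^ 2 : ℝ) : ℂ)
    (by simp [hφ]) (by simp [h1]) (by simpa using hr) k
  rw [h2]
  simpa [map_cheb] using this

end FreeTrace

namespace FreeTrace

variable {𝓐 : Type*} [CStarAlgebra 𝓐]

/-! ### Wick products -/

/-- The Wick product of a list of elements. -/
def wick (φ : 𝓐 →ₗ[ℂ] ℂ) : List 𝓐 → 𝓐
  | [] => 1
  | [a] => a
  | a :: b :: w => a * wick φ (b :: w) - φ (a * b) • wick φ w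

/-- The contraction of `a` with the first factor of a Wick product. -/
def wickContraction (φ : 𝓐 →ₗ[ℂ] ℂ) (a : 𝓐) : List 𝓐 → 𝓐
  | [] => 0
  | b :: w => φ (a * b) • wick φ w

theorem wick_cons (φ : 𝓐 →ₗ[ℂ] ℂ) (a : 𝓐) (w : List 𝓐) :
    wick φ (a :: w) = a * wick φ w - wickContraction φ a w := by
  cases w with
  | nil => simp [wick, wickContraction]
  | cons b w => rfl

/-- Linearity in an arbitrary slot. The affine form c • a + b covers sums, multiples and, with c =
-1, the zero vector at once. -/
theorem wick_linear (φ : 𝓐 →ₗ[ℂ] ℂ) (c : ℂ) (a b : 𝓐) (v : List 𝓐) :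
    ∀ u : List 𝓐, wick φ (u ++ (c • a + b) :: v) =
      c • wick φ (u ++ a :: v) + wick φ (u ++ b :: v)
  | [] => by
    rcases v with _ | ⟨d, v⟩
    · rfl
    · simp only [List.nil_append, wick, add_mul, smul_mul_assoc, map_add, map_smul, smul_sub,
        add_smul, smul_assoc]
      abel
  | [x] => by
    have := wick_linear φ c a b v []
    simp only [List.nil_append] at this
    simp only [List.cons_append, List.nil_append, wick, this, mul_add, mul_smul_comm, map_add,
      map_smul, smul_sub, add_smul, smul_assoc]
    abel
  | x :: y :: u => by
    have h1 := wick_linear φ c a b v (y :: u)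
    have h2 := wick_linear φ c a b v u
    simp only [List.cons_append] at h1
    simp only [List.cons_append, wick, h1, h2, mul_add, mul_smul_comm, smul_add, smul_sub,
      smul_comm (φ (x * y)) c]
    abel

/-- Letters are replaced from left to right: `u` is the prefix already reduced to generators and `v`
the part still in the span. -/
theorem map_wick_eq_zero_of_mem_span (φ : 𝓐 →ₗ[ℂ] ℂ) {Y : Set 𝓐}
    (hY : ∀ w : List 𝓐, w ≠ [] → (∀ a ∈ w, a ∈ Y) → φ (wick φ w) = 0) (v : List 𝓐)
    (hv : ∀ a ∈ v, a ∈ Submodule.span ℂ Y) :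
    ∀ u : List 𝓐, (∀ a ∈ u, a ∈ Y) → u ++ v ≠ [] → φ (wick φ (u ++ v)) = 0 := by
  induction v with
  | nil =>
    intro u hu hne
    rw [List.append_nil] at hne ⊢
    exact hY u hne hu
  | cons a v ih =>
    intro u hu hne
    have ha := hv a List.mem_cons_self
    have ih := ih fun b hb => hv b (List.mem_cons_of_mem a hb)
    clear hne hv
    induction ha using Submodule.span_induction with
    | mem a ha =>
      have := ih (u ++ [a]) (by
        intro b hb
        rcases List.mem_append.1 hb with hb | hb
        · exact hu b hb
        · rwa [List.mem_singleton.1 hb]) (by simp)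
      simpa using this
    | zero =>
      have := wick_linear φ (-1) (0 : 𝓐) 0 v u
      rw [smul_zero, add_zero, neg_one_smul, neg_add_cancel] at this
      rw [this, map_zero]
    | add a b _ _ ha hb =>
      have := wick_linear φ 1 a b v u
      rw [one_smul, one_smul] at this
      rw [this, map_add, ha, hb, add_zero]
    | smul t a _ ha =>
      have h0 := wick_linear φ (-1) (0 : 𝓐) 0 v u
      rw [smul_zero, add_zero, neg_one_smul, neg_add_cancel] at h0
      have := wick_linear φ t a 0 v u
      rw [add_zero, h0, add_zero] at this
      rw [this, map_smul, ha, smul_zero]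

/-! ### Wick products of free semicircular elements -/

section Free

variable {X : Type*}

/-- Within a run of equal letters the Wick recursion is the Chebyshev recursion with s the variance;
across the end of the run the contraction is zero. -/
theorem wick_replicate_append {φ : 𝓐 →ₗ[ℂ] ℂ} {y : X → 𝓐}
    (hxy : ∀ x x', x ≠ x' → φ (y x * y x') = 0) (x : X) (w : List X)
    (hw : ∀ x' ∈ w.head?, x ≠ x') :
    ∀ k : ℕ, wick φ ((List.replicate k x ++ w).map y) =
      cheb (φ (y x * y x)) (y x) k * wick φ (w.map y)
  | 0 => by simp [cheb]
  | 1 => by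
    rcases w with _ | ⟨x', w⟩
    · simp [cheb, wick]
    · have := hxy x x' (hw x' rfl)
      simp [cheb, wick, this]
  | k + 2 => by
    have h1 := wick_replicate_append hxy x w hw (k + 1)
    have h2 := wick_replicate_append hxy x w hw k
    rw [List.replicate_succ, List.cons_append, List.map_cons] at h1
    rw [List.replicate_succ, List.replicate_succ, List.cons_append, List.cons_append,
      List.map_cons, List.map_cons, wick, h1, h2, cheb, sub_mul, mul_assoc, smul_mul_assoc]

/-- A Wick product of generators is an alternating product of Chebyshev polynomials. -/
theorem exists_wick_eq_prod {φ : 𝓐 →ₗ[ℂ] ℂ} {y : X → 𝓐}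
    (hxy : ∀ x x', x ≠ x' → φ (y x * y x') = 0) (v : List X) (hv : v ≠ []) :
    ∃ b : List (X × ℕ), b ≠ [] ∧ (b.map Prod.fst).IsChain (· ≠ ·) ∧
      (∀ x ∈ v.head?, x ∈ (b.map Prod.fst).head?) ∧
      wick φ (v.map y) =
        (b.map fun p => cheb (φ (y p.1 * y p.1)) (y p.1) (p.2 + 1)).prod := by
  classical
  induction h : v.length using Nat.strong_induction_on generalizing v with
  | _ n ih =>
    obtain ⟨x, v, rfl⟩ := List.exists_cons_of_ne_nil hv
    -- Split off the maximal run of the first letter. Maximality makes the next letter different, so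
    -- the colours of the factors alternate.
    obtain ⟨k, w, hkw, hw⟩ : ∃ k w, v = List.replicate k x ++ w ∧ ∀ x' ∈ w.head?, x ≠ x' := by
      clear h hv
      induction v with
      | nil => exact ⟨0, [], rfl, by simp⟩
      | cons z v ih' =>
        by_cases hz : z = x
        · obtain ⟨k, w, rfl, hw⟩ := ih'
          exact ⟨k + 1, w, by rw [hz, List.replicate_succ, List.cons_append], hw⟩
        · exact ⟨0, z :: v, rfl, by simpa using Ne.symm hz⟩
    have e : wick φ ((x :: v).map y) = _ :=
      (congrArg (fun l => wick φ (List.map y l)) (by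
        rw [hkw, List.replicate_succ, List.cons_append])).trans
        (wick_replicate_append hxy x w hw (k + 1))
    rcases eq_or_ne w [] with rfl | hw0
    · exact ⟨[(x, k)], by simp, by simp, by simp, by rw [e]; simp [wick]⟩
    · obtain ⟨b, hb0, hb1, hb2, hb3⟩ := ih w.length (by
        rw [← h, hkw]; simp) w hw0 rfl
      refine ⟨(x, k) :: b, by simp, ?_, by simp, by rw [e, hb3]; simp⟩
      rw [List.map_cons, List.isChain_cons]
      refine ⟨fun z hz => ?_, hb1⟩
      obtain ⟨x', w', rfl⟩ := List.exists_cons_of_ne_nil hw0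
      have := hb2 x' rfl
      rw [Option.mem_def] at this hz
      rw [this] at hz
      exact hw z (by simpa using hz)

theorem map_wick_eq_zero_of_free {φ : 𝓐 →ₗ[ℂ] ℂ} (hφ : φ 1 = 1) {y : X → 𝓐}
    (hy : ∀ x, IsCenteredSemicircular φ (y x)) (hfree : FreeFamily φ y) (v : List X)
    (hv : v ≠ []) : φ (wick φ (v.map y)) = 0 := by
  have hc : ∀ x k, φ (cheb (φ (y x * y x)) (y x) (k + 1)) = 0 := fun x k =>
    (hy x).map_cheb_eq_zero hφ k
  have hxy : ∀ x x', x ≠ x' → φ (y x * y x') = 0 := by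
    intro x x' hne
    have := hfree 2 (by norm_num) ![x, x'] ![y x, y x'] (by
      intro i
      fin_cases i <;> exact Algebra.subset_adjoin rfl) (by
      intro i
      fin_cases i
      exacts [hc x 0, hc x' 0]) (by
      intro i h
      obtain rfl : i = 0 := by omega
      exact hne)
    simpa [List.ofFn_succ] using this
  obtain ⟨b, hb0, hb1, -, hb3⟩ := exists_wick_eq_prod hxy v hv
  rw [hb3]
  have e : (b.map fun p => cheb (φ (y p.1 * y p.1)) (y p.1) (p.2 + 1)) =
      List.ofFn fun i : Fin b.length =>
        cheb (φ (y b[i].1 * y b[i].1)) (y b[i].1) (b[i].2 + 1) := by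
    refine List.ext_getElem (by simp) fun i h1 h2 => ?_
    simp
  rw [e]
  refine hfree b.length (List.length_pos_iff.2 hb0) (fun i => b[i].1) _
    (fun i => cheb_mem_adjoin _ _ _) (fun i => hc _ _) fun i h => ?_
  have := List.isChain_iff_getElem.1 hb1 i (by simpa using h)
  simpa using this

end Free

/-! ### Pairing of Wick products -/

/-- Polarisation: positivity makes φ real on b* b, and b = a, 1 + a, 1 + i a determine the imaginary
and real parts. -/
theorem IsState.map_star {φ : 𝓐 →ₗ[ℂ] ℂ} (hφ : IsState φ) (a : 𝓐) :
    φ (star a) = star (φ a) := by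
  have hre : ∀ b : 𝓐, (φ (star b * b)).im = 0 := fun b => by
    have := (Complex.le_def.1 (hφ.nonneg b)).2
    simpa using this.symm
  have h0 := hre a
  have h1 := hre (1 + a)
  have h2 := hre (1 + Complex.I • a)
  have e : star Complex.I = -Complex.I := Complex.conj_I
  simp only [star_add, star_one, star_smul, add_mul, mul_add, one_mul, mul_one, map_add, hφ.map_one,
    Complex.add_im, h0, neg_mul, smul_mul_assoc, mul_smul_comm, map_smul, smul_eq_mul, Complex.one_im, e,
    neg_smul, map_neg, Complex.neg_im, Complex.mul_im, Complex.I_re, Complex.I_im, Complex.neg_re,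
    Complex.mul_re] at h1 h2
  apply Complex.ext
  · simp only [Complex.star_def, Complex.conj_re]
    linarith
  · simp only [Complex.star_def, Complex.conj_im]
    linarith

/-- The full contraction of two words with respect to a covariance. -/
def pairing {X : Type*} (g : X → X → ℂ) : List X → List X → ℂ
  | [], [] => 1
  | x :: u, y :: v => g x y * pairing g u v
  | [], _ :: _ => 0
  | _ :: _, [] => 0

/-- The outer letter a of `u` is moved across as a* and prepended to `v`, which shortens `u`; this
is why `L` must be closed under adjoints. Only centeredness of Wick words is used, not freeness. -/
theorem map_star_wick_mul_wick {φ : 𝓐 →ₗ[ℂ] ℂ} (hφ : IsState φ) {L : Set 𝓐}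
    (hL : ∀ a ∈ L, star a ∈ L)
    (hw : ∀ w : List 𝓐, w ≠ [] → (∀ a ∈ w, a ∈ L) → φ (wick φ w) = 0) :
    ∀ u v : List 𝓐, (∀ a ∈ u, a ∈ L) → (∀ a ∈ v, a ∈ L) →
      φ (star (wick φ u) * wick φ v) = pairing (fun a b => φ (star a * b)) u v
  | [], [], _, _ => by simp [wick, pairing, hφ.map_one]
  | [], b :: v, _, hv => by simp [wick, pairing, hw (b :: v) (by simp) hv]
  | [a], v, hu, hv => by
    have h1 := hw (star a :: v) (by simp) (by
      intro b hb
      rcases List.mem_cons.1 hb with rfl | hb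
      · exact hL a (hu a (by simp))
      · exact hv b hb)
    rw [wick_cons, map_sub, sub_eq_zero] at h1
    rw [wick, h1]
    rcases v with _ | ⟨b, v⟩
    · simp [pairing, wickContraction]
    · rw [wickContraction, pairing, map_smul, smul_eq_mul]
      congr 1
      rcases v with _ | ⟨d, v⟩
      · simp [pairing, wick, hφ.map_one]
      · rw [pairing, hw _ (by simp) fun x hx => hv x (List.mem_cons_of_mem _ hx)]
  | a :: a' :: u, v, hu, hv => by
    have ha : star a ∈ L := hL a (hu a (by simp))
    have hu1 : ∀ x ∈ a' :: u, x ∈ L := fun x hx => hu x (List.mem_cons_of_mem _ hx)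
    have hu2 : ∀ x ∈ u, x ∈ L := fun x hx => hu1 x (List.mem_cons_of_mem _ hx)
    have h1 := map_star_wick_mul_wick hφ hL hw (a' :: u) (star a :: v) hu1 (by
      intro b hb
      rcases List.mem_cons.1 hb with rfl | hb
      · exact ha
      · exact hv b hb)
    have h2 := map_star_wick_mul_wick hφ hL hw u v hu2 hv
    have e : star a * wick φ v = wick φ (star a :: v) + wickContraction φ (star a) v := by
      rw [wick_cons]; abel
    have hs : star (φ (a * a')) = φ (star a' * star a) := by rw [← hφ.map_star, star_mul]
    -- The uncontracted term pairs a' with a* and cancels the correction coming from the contraction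
    -- of a with a'; only the contraction of a* with the head of `v` remains.
    rw [wick, star_sub, star_mul, star_smul, sub_mul, mul_assoc, e, mul_add, map_sub, map_add, h1,
      smul_mul_assoc, map_smul, h2, hs, pairing, smul_eq_mul, add_sub_cancel_left]
    rcases v with _ | ⟨b, v⟩
    · simp [wickContraction, pairing]
    · rw [wickContraction, mul_smul_comm, map_smul, smul_eq_mul, pairing,
        map_star_wick_mul_wick hφ hL hw (a' :: u) v hu1 fun x hx => hv x (List.mem_cons_of_mem _ hx)]

end FreeTrace

namespace FreeTrace

variable {𝓐 : Type*} [CStarAlgebra 𝓐] {N : ℕ}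

/-! ### Constant matrices and traces -/

theorem const_one : const 𝓐 (1 : Matrix (Fin N) (Fin N) ℂ) = 1 :=
  Matrix.map_one _ (map_zero _) (map_one _)

theorem conjTranspose_const (A : Matrix (Fin N) (Fin N) ℂ) :
    (const 𝓐 A).conjTranspose = const 𝓐 A.conjTranspose := by
  ext i j
  simp only [const, Matrix.conjTranspose_apply, Matrix.map_apply, algebraMap_star_comm]

theorem ntr_one (hN : 0 < N) : ntr (1 : Matrix (Fin N) (Fin N) ℂ) = 1 := by
  have : (N : ℂ) ≠ 0 := by exact_mod_cast hN.ne'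
  simp [ntr, this]

theorem ntr_conjTranspose (A : Matrix (Fin N) (Fin N) ℂ) :
    ntr A.conjTranspose = star (ntr A) := by
  simp [ntr, Matrix.trace_conjTranspose]

theorem ntrState_one {φ : 𝓐 →ₗ[ℂ] ℂ} (hφ : φ 1 = 1) (hN : 0 < N) :
    ntrState φ (1 : Matrix (Fin N) (Fin N) 𝓐) = 1 := by
  have : (N : ℂ) ≠ 0 := by exact_mod_cast hN.ne'
  have e : φ ((N : ℕ) : 𝓐) = N := by
    rw [← nsmul_one, map_nsmul, hφ, nsmul_one]
  simp [ntrState, this, e]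

theorem ntrState_conjTranspose {φ : 𝓐 →ₗ[ℂ] ℂ} (hφ : IsState φ) (X : Matrix (Fin N) (Fin N) 𝓐) :
    ntrState φ X.conjTranspose = star (ntrState φ X) := by
  simp [ntrState, Matrix.trace_conjTranspose, hφ.map_star]

/-- `ntrState φ` as a linear map. -/
def ntrStateLinear (φ : 𝓐 →ₗ[ℂ] ℂ) : Matrix (Fin N) (Fin N) 𝓐 →ₗ[ℂ] ℂ :=
  (N : ℂ)⁻¹ • (φ ∘ₗ Matrix.traceLinearMap (Fin N) ℂ 𝓐)

theorem ntrStateLinear_apply (φ : 𝓐 →ₗ[ℂ] ℂ) (X : Matrix (Fin N) (Fin N) 𝓐) :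
    ntrStateLinear φ X = ntrState φ X := rfl

/-! ### Wick products of matrices -/

variable {ι : Type*}

/-- The entry of the family `T` with the given label. -/
def entry (T : ι → Matrix (Fin N) (Fin N) 𝓐) (x : ι × Fin N × Fin N) : 𝓐 := T x.1 x.2.1 x.2.2

/-- The entries of the family `T` of self-adjoint matrices have the covariance of independent
semicircular matrices, and their Wick products are centered. -/
structure IsWickFamily (φ : 𝓐 →ₗ[ℂ] ℂ) (T : ι → Matrix (Fin N) (Fin N) 𝓐) : Prop where
  covariance : ∀ i j p q r t, φ (T i p q * T j r t) =
    open Classical in if i = j ∧ p = t ∧ q = r then (N : ℂ)⁻¹ else 0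
  star_apply : ∀ i p q, star (T i p q) = T i q p
  map_wick : ∀ w : List (ι × Fin N × Fin N), w ≠ [] → φ (wick φ (w.map (entry T))) = 0

section WordSum

variable {E : Type*} [AddCommGroup E] [Module ℂ E]

/-- The `(p, q)` entry of the formal product `X_{i₁} C₁ X_{i₂} C₂ ⋯`, with the word of the entries
of the `X` replaced by its value under `F`. -/
def wordSum : List (ι × Matrix (Fin N) (Fin N) ℂ) → (List (ι × Fin N × Fin N) → E) →
    Fin N → Fin N → E
  | [], F, p, q => if p = q then F [] else 0
  | x :: v, F, p, q => ∑ r, ∑ t, x.2 r t • wordSum v (fun w => F ((x.1, p, r) :: w)) t q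

theorem map_wordSum {E' : Type*} [AddCommGroup E'] [Module ℂ E'] (L : E →ₗ[ℂ] E')
    (v : List (ι × Matrix (Fin N) (Fin N) ℂ)) (F : List (ι × Fin N × Fin N) → E) (p q : Fin N) :
    L (wordSum v F p q) = wordSum v (fun w => L (F w)) p q := by
  induction v generalizing F p with
  | nil => simp only [wordSum]; split_ifs <;> simp
  | cons x v ih => simp only [wordSum, map_sum, map_smul, ih]

theorem wordSum_sub (v : List (ι × Matrix (Fin N) (Fin N) ℂ))
    (F G : List (ι × Fin N × Fin N) → E) (p q : Fin N) :
    wordSum v (fun w => F w - G w) p q = wordSum v F p q - wordSum v G p q := by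
  induction v generalizing F G p with
  | nil => simp only [wordSum]; split_ifs <;> simp
  | cons x v ih => simp only [wordSum, ih, smul_sub, Finset.sum_sub_distrib]

theorem wordSum_zero (v : List (ι × Matrix (Fin N) (Fin N) ℂ)) (p q : Fin N) :
    wordSum v (fun _ => (0 : E)) p q = 0 := by
  simpa using wordSum_sub v (fun _ => (0 : E)) (fun _ => 0) p q

theorem wordSum_smul (c : ℂ) (v : List (ι × Matrix (Fin N) (Fin N) ℂ))
    (F : List (ι × Fin N × Fin N) → E) (p q : Fin N) :
    wordSum v (fun w => c • F w) p q = c • wordSum v F p q :=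
  (map_wordSum (c • LinearMap.id) v F p q).symm

theorem wordSum_finset_sum {κ : Type*} (s : Finset κ) (v : List (ι × Matrix (Fin N) (Fin N) ℂ))
    (F : κ → List (ι × Fin N × Fin N) → E) (p q : Fin N) :
    wordSum v (fun w => ∑ k ∈ s, F k w) p q = ∑ k ∈ s, wordSum v (F k) p q := by
  induction v generalizing F p with
  | nil => simp only [wordSum]; split_ifs <;> simp
  | cons x v ih =>
    simp only [wordSum, ih, Finset.smul_sum]
    rw [Finset.sum_congr rfl fun r _ => Finset.sum_comm, Finset.sum_comm]

/-- The double sum of a kernel over the words of two formal products of matrices, linear in the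
second and conjugate-linear in the first product. -/
def wordPairing (K : List (ι × Fin N × Fin N) → List (ι × Fin N × Fin N) → ℂ)
    (u v : List (ι × Matrix (Fin N) (Fin N) ℂ)) (a b p q : Fin N) : ℂ :=
  wordSum v (fun w => star (wordSum u (fun w' => star (K w' w)) a b)) p q

theorem wordPairing_mul (c : ℂ) (K : List (ι × Fin N × Fin N) → List (ι × Fin N × Fin N) → ℂ)
    (u v : List (ι × Matrix (Fin N) (Fin N) ℂ)) (a b p q : Fin N) :
    wordPairing (fun w' w => c * K w' w) u v a b p q = c * wordPairing K u v a b p q := by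
  have h : ∀ w, wordSum u (fun w' => star c * star (K w' w)) a b =
      star c * wordSum u (fun w' => star (K w' w)) a b := fun w =>
    wordSum_smul (star c) u (fun w' => star (K w' w)) a b
  simp only [wordPairing, star_mul', h, star_star]
  exact wordSum_smul c v (fun w => star (wordSum u (fun w' => star (K w' w)) a b)) p q

theorem wordPairing_cons_cons
    (K : List (ι × Fin N × Fin N) → List (ι × Fin N × Fin N) → ℂ)
    (x y : ι × Matrix (Fin N) (Fin N) ℂ)
    (u v : List (ι × Matrix (Fin N) (Fin N) ℂ)) (a b p q : Fin N) :
    wordPairing K (x :: u) (y :: v) a b p q =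
      ∑ r', ∑ t', ∑ r, ∑ t, y.2 r' t' * (star (x.2 r t) *
        wordPairing (fun w' w => K ((x.1, a, r) :: w') ((y.1, p, r') :: w)) u v t b t' q) := by
  have h : ∀ (c : ℂ) (F : List (ι × Fin N × Fin N) → ℂ) t',
      wordSum v (fun w => c * F w) t' q = c * wordSum v F t' q := fun c F t' =>
    wordSum_smul c v F t' q
  simp only [wordPairing, wordSum, star_sum, smul_eq_mul, star_mul', wordSum_finset_sum, h,
    Finset.mul_sum]

theorem wordPairing_nil_cons {K : List (ι × Fin N × Fin N) → List (ι × Fin N × Fin N) → ℂ}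
    (hK : ∀ x w, K [] (x :: w) = 0) (y : ι × Matrix (Fin N) (Fin N) ℂ)
    (v : List (ι × Matrix (Fin N) (Fin N) ℂ)) (a b p q : Fin N) :
    wordPairing K [] (y :: v) a b p q = 0 := by
  simp [wordPairing, wordSum, hK, wordSum_zero]

theorem wordPairing_cons_nil {K : List (ι × Fin N × Fin N) → List (ι × Fin N × Fin N) → ℂ}
    (hK : ∀ x w, K (x :: w) [] = 0) (x : ι × Matrix (Fin N) (Fin N) ℂ)
    (u : List (ι × Matrix (Fin N) (Fin N) ℂ)) (a b p q : Fin N) :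
    wordPairing K (x :: u) [] a b p q = 0 := by
  simp [wordPairing, wordSum, hK, wordSum_zero]

end WordSum

/-- The Wick product of the matrices `T i₁ C₁ T i₂ C₂ ⋯`. -/
def matrixWick (φ : 𝓐 →ₗ[ℂ] ℂ) (T : ι → Matrix (Fin N) (Fin N) 𝓐)
    (v : List (ι × Matrix (Fin N) (Fin N) ℂ)) : Matrix (Fin N) (Fin N) 𝓐 :=
  Matrix.of fun p q => wordSum v (fun w => wick φ (w.map (entry T))) p q

theorem matrixWick_nil (φ : 𝓐 →ₗ[ℂ] ℂ) (T : ι → Matrix (Fin N) (Fin N) 𝓐) :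
    matrixWick φ T [] = 1 := by
  ext p q
  simp [matrixWick, wordSum, wick, Matrix.one_apply]

theorem matrixWick_cons_apply (φ : 𝓐 →ₗ[ℂ] ℂ) (T : ι → Matrix (Fin N) (Fin N) 𝓐) (i : ι)
    (C : Matrix (Fin N) (Fin N) ℂ) (v : List (ι × Matrix (Fin N) (Fin N) ℂ)) (p q : Fin N) :
    matrixWick φ T ((i, C) :: v) p q = (T i * const 𝓐 C * matrixWick φ T v) p q -
      ∑ r, ∑ t, C r t •
        wordSum v (fun w => wickContraction φ (T i p r) (w.map (entry T))) t q := by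
  have h : ∀ r t, wordSum v (fun w => T i p r * wick φ (w.map (entry T))) t q =
      T i p r * matrixWick φ T v t q := fun r t =>
    (map_wordSum (LinearMap.mulLeft ℂ (T i p r)) v _ t q).symm
  simp only [matrixWick, Matrix.of_apply, wordSum, List.map_cons, wick_cons, wordSum_sub, smul_sub,
    Finset.sum_sub_distrib]
  congr 1
  simp only [entry, h, Matrix.mul_apply, Finset.sum_mul]
  rw [Finset.sum_comm]
  refine Finset.sum_congr rfl fun t _ => Finset.sum_congr rfl fun r _ => ?_
  rw [const, Matrix.map_apply, ← Algebra.commutes, ← Algebra.smul_def, smul_mul_assoc]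
  rfl

theorem matrixWick_singleton (φ : 𝓐 →ₗ[ℂ] ℂ) (T : ι → Matrix (Fin N) (Fin N) 𝓐) (i : ι)
    (C : Matrix (Fin N) (Fin N) ℂ) : matrixWick φ T [(i, C)] = T i * const 𝓐 C := by
  ext p q
  rw [matrixWick_cons_apply, matrixWick_nil, mul_one, sub_eq_self]
  simp [wordSum, wickContraction]

-- Contracting the first two letters forces equal colours, p = t for the outer row index, and equal
-- indices at both ends of C. The latter sum is the trace of C, normalised by the covariance 1/N,
-- and `D` is left at the front.
open Classical in
theorem IsWickFamily.matrixWick_cons_cons {φ : 𝓐 →ₗ[ℂ] ℂ}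
    {T : ι → Matrix (Fin N) (Fin N) 𝓐} (hT : IsWickFamily φ T) (i j : ι)
    (C D : Matrix (Fin N) (Fin N) ℂ) (v : List (ι × Matrix (Fin N) (Fin N) ℂ)) :
    matrixWick φ T ((i, C) :: (j, D) :: v) = T i * const 𝓐 C * matrixWick φ T ((j, D) :: v) -
      (if i = j then ntr C else 0) • (const 𝓐 D * matrixWick φ T v) := by
  ext p q
  rw [matrixWick_cons_apply, Matrix.sub_apply]
  congr 1
  have h : ∀ c t, wordSum v (fun w => c • wick φ (w.map (entry T))) t q =
      c • matrixWick φ T v t q := fun c t => wordSum_smul c v _ t q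
  simp only [wordSum, List.map_cons, wickContraction, entry, hT.covariance, h]
  by_cases hij : i = j
  · simp only [hij, true_and, ite_smul, zero_smul, smul_ite, smul_zero, if_true, Matrix.smul_apply,
      Matrix.mul_apply, ite_and, Finset.sum_ite_eq, Finset.mem_univ, Finset.sum_ite_irrel, Finset.sum_const_zero, const, Matrix.map_apply, ntr,
      Matrix.trace, Matrix.diag]
    simp only [Finset.mul_sum, Finset.sum_smul, Finset.smul_sum]
    rw [Finset.sum_comm]
    refine Finset.sum_congr rfl fun r _ => Finset.sum_congr rfl fun t _ => ?_
    rw [← Algebra.smul_def, smul_smul, smul_smul, smul_smul]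
    congr 1
    ring
  · simp [hij]

/-! ### Covariances of matrix Wick products -/

/-- The covariance of two letters of a formal product of matrices. -/
def letterPairing (x y : ι × Matrix (Fin N) (Fin N) ℂ) : ℂ :=
  open Classical in if x.1 = y.1 then ntr (x.2.conjTranspose * y.2) else 0

theorem pairing_map {X Y : Type*} (g : Y → Y → ℂ) (e : X → Y) : ∀ u v : List X,
    pairing g (u.map e) (v.map e) = pairing (fun x y => g (e x) (e y)) u v
  | [], [] => rfl
  | x :: u, y :: v => by simp only [List.map_cons, pairing, pairing_map g e u v]
  | [], _ :: _ => rfl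
  | _ :: _, [] => rfl

theorem IsWickFamily.map_star_wick_mul_wick {φ : 𝓐 →ₗ[ℂ] ℂ} (hφ : IsState φ)
    {T : ι → Matrix (Fin N) (Fin N) 𝓐} (hT : IsWickFamily φ T) (u v : List (ι × Fin N × Fin N)) :
    φ (star (wick φ (u.map (entry T))) * wick φ (v.map (entry T))) =
      pairing (fun x y => φ (star (entry T x) * entry T y)) u v := by
  have hmem : ∀ w : List (ι × Fin N × Fin N), ∀ a ∈ w.map (entry T), a ∈ Set.range (entry T) := by
    intro w a ha
    obtain ⟨x, -, rfl⟩ := List.mem_map.1 ha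
    exact ⟨x, rfl⟩
  rw [FreeTrace.map_star_wick_mul_wick hφ (L := Set.range (entry T)) _ _ _ _ (hmem u) (hmem v),
    pairing_map]
  · rintro _ ⟨x, rfl⟩
    exact ⟨(x.1, x.2.2, x.2.1), (hT.star_apply _ _ _).symm⟩
  · intro w hw hwT
    obtain ⟨w, rfl⟩ : w ∈ Set.range (List.map (entry T)) := by
      rw [Set.range_list_map]
      exact hwT
    exact hT.map_wick w (by simpa using hw)

theorem IsWickFamily.map_star_matrixWick_mul_eq_wordPairing {φ : 𝓐 →ₗ[ℂ] ℂ} (hφ : IsState φ)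
    {T : ι → Matrix (Fin N) (Fin N) 𝓐} (hT : IsWickFamily φ T)
    (u v : List (ι × Matrix (Fin N) (Fin N) ℂ)) (a b p q : Fin N) :
    φ (star (matrixWick φ T u a b) * matrixWick φ T v p q) =
      wordPairing (pairing fun x y => φ (star (entry T x) * entry T y)) u v a b p q := by
  have h1 := map_wordSum (φ ∘ₗ LinearMap.mulLeft ℂ (star (matrixWick φ T u a b))) v
    (fun w => wick φ (w.map (entry T))) p q
  refine h1.trans (congrArg (fun F => wordSum v F p q) (funext fun w => ?_))
  have h2 := map_wordSum (φ ∘ₗ LinearMap.mulLeft ℂ (star (wick φ (w.map (entry T))))) u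
    (fun w => wick φ (w.map (entry T))) a b
  simp only [LinearMap.comp_apply, LinearMap.mulLeft_apply] at h2 ⊢
  rw [← star_star (wick φ (w.map (entry T))), ← star_mul, hφ.map_star]
  refine congrArg star (h2.trans (congrArg (fun F => wordSum u F a b) (funext fun w' => ?_)))
  rw [← hT.map_star_wick_mul_wick hφ, ← hφ.map_star, star_mul, star_star]

/-- The covariances of the entries of Wick products. -/
theorem IsWickFamily.exists_map_star_matrixWick_mul {φ : 𝓐 →ₗ[ℂ] ℂ} (hφ : IsState φ)
    {T : ι → Matrix (Fin N) (Fin N) 𝓐} (hT : IsWickFamily φ T)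
    (u v : List (ι × Matrix (Fin N) (Fin N) ℂ)) (huv : u ≠ [] ∨ v ≠ []) :
    ∃ G : Matrix (Fin N) (Fin N) ℂ, G.trace = pairing letterPairing u v ∧
      ∀ a b p q, φ (star (matrixWick φ T u a b) * matrixWick φ T v p q) =
        if a = p then G b q else 0 := by
  classical
  simp only [hT.map_star_matrixWick_mul_eq_wordPairing hφ]
  have hg : ∀ i j a r p r', φ (star (entry T (i, a, r)) * entry T (j, p, r')) =
      if i = j ∧ a = p ∧ r = r' then (N : ℂ)⁻¹ else 0 := by
    intro i j a r p r'
    -- Taking the adjoint swaps the matrix indices, so the covariance now matches row with row and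
    -- column with column.
    simp only [entry, hT.star_apply, hT.covariance]
    congr 1
    simp only [eq_iff_iff]
    tauto
  have hcons : ∀ (x y : ι × Matrix (Fin N) (Fin N) ℂ) u v a b p q,
      wordPairing (pairing fun x y => φ (star (entry T x) * entry T y)) (x :: u) (y :: v) a b p q =
        if x.1 = y.1 ∧ a = p then ∑ r, ∑ t', ∑ t, y.2 r t' * (star (x.2 r t) * ((N : ℂ)⁻¹ *
          wordPairing (pairing fun x y => φ (star (entry T x) * entry T y)) u v t b t' q))
        else 0 := by
    intro x y u v a b p q
    rw [wordPairing_cons_cons]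
    simp only [pairing, wordPairing_mul]
    generalize wordPairing (pairing fun x y => φ (star (entry T x) * entry T y)) = Z
    simp only [hg, ite_mul, zero_mul, mul_ite, mul_zero, ite_and]
    split_ifs <;> simp
  induction u generalizing v with
  | nil =>
    rcases v with _ | ⟨y, v⟩
    · simp at huv
    · exact ⟨0, by simp [pairing], fun a b p q => by
        rw [wordPairing_nil_cons fun _ _ => rfl]; simp⟩
  | cons x u ih =>
    rcases v with _ | ⟨y, v⟩
    · exact ⟨0, by simp [pairing], fun a b p q => by
        rw [wordPairing_cons_nil fun _ _ => rfl]; simp⟩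
    · simp only [hcons, pairing, letterPairing]
      by_cases hxy : x.1 = y.1
      -- If both tails are empty, the next indices are tied to b and q instead of to each other, so
      -- G is (1/N) C* D. Otherwise the tails force t = t' and this letter contributes the scalar
      -- tr(C* D). Two empty words do not have the stated form, hence `huv`.
      · by_cases h : u ≠ [] ∨ v ≠ []
        · obtain ⟨G, hG, hG'⟩ := ih v h
          refine ⟨ntr (x.2.conjTranspose * y.2) • G, ?_, fun a b p q => ?_⟩
          · rw [Matrix.trace_smul, hG, if_pos hxy, smul_eq_mul]
          · simp only [hG', hxy, true_and]
            congr 1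
            simp only [mul_ite, mul_zero, Finset.sum_ite_eq', Finset.mem_univ, if_true, ntr,
              Matrix.trace, Matrix.diag, Matrix.mul_apply, Matrix.smul_apply,
              Matrix.conjTranspose_apply, smul_eq_mul, Finset.mul_sum, Finset.sum_mul]
            rw [Finset.sum_comm]
            refine Finset.sum_congr rfl fun t _ => Finset.sum_congr rfl fun r _ => ?_
            ring
        · obtain ⟨rfl, rfl⟩ : u = [] ∧ v = [] := by simpa using h
          refine ⟨(N : ℂ)⁻¹ • (x.2.conjTranspose * y.2), ?_, fun a b p q => ?_⟩
          · simp [hxy, pairing, ntr]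
          · simp only [hxy, true_and]
            congr 1
            simp only [wordPairing, wordSum, pairing, star_one, Matrix.smul_apply,
              Matrix.mul_apply, Matrix.conjTranspose_apply, smul_eq_mul, Finset.mul_sum]
            refine Finset.sum_congr rfl fun r _ => ?_
            simp only [apply_ite star, star_one, star_zero, mul_ite, mul_zero, mul_one,
              Finset.sum_ite_eq', Finset.mem_univ, if_true, Finset.sum_ite_irrel,
              Finset.sum_const_zero]
            ring
      · exact ⟨0, by simp [hxy], fun a b p q => by simp [hxy]⟩

end FreeTrace

namespace FreeTrace

variable {𝓐 : Type*} [CStarAlgebra 𝓐] {N : ℕ} {ι : Type*}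

/-! ### Alternating products of Chebyshev polynomials -/

/-- With covariance δ_{ap} G_{bq}, setting a = b and p = q leaves Σ_a G_{aa}. -/
theorem IsWickFamily.map_star_trace_mul {φ : 𝓐 →ₗ[ℂ] ℂ} (hφ : IsState φ)
    {T : ι → Matrix (Fin N) (Fin N) 𝓐} (hT : IsWickFamily φ T)
    (u v : List (ι × Matrix (Fin N) (Fin N) ℂ)) (huv : u ≠ [] ∨ v ≠ []) :
    φ (star (matrixWick φ T u).trace * (matrixWick φ T v).trace) =
      pairing letterPairing u v := by
  obtain ⟨G, hG, hG'⟩ := hT.exists_map_star_matrixWick_mul hφ u v huv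
  simp [Matrix.trace, ← hG, star_sum, Finset.sum_mul_sum, hG']

/-- Here the row index is free and contributes a factor N, which the normalisation removes. The
value is therefore the same as for the product of traces. -/
theorem IsWickFamily.ntrState_conjTranspose_mul {φ : 𝓐 →ₗ[ℂ] ℂ} (hφ : IsState φ) (hN : 0 < N)
    {T : ι → Matrix (Fin N) (Fin N) 𝓐} (hT : IsWickFamily φ T)
    (u v : List (ι × Matrix (Fin N) (Fin N) ℂ)) (huv : u ≠ [] ∨ v ≠ []) :
    ntrState φ ((matrixWick φ T u).conjTranspose * matrixWick φ T v) =
      pairing letterPairing u v := by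
  have hN' : (N : ℂ) ≠ 0 := by exact_mod_cast hN.ne'
  obtain ⟨G, hG, hG'⟩ := hT.exists_map_star_matrixWick_mul hφ u v huv
  simp [ntrState, Matrix.trace, Matrix.mul_apply, ← hG, hG', ← Finset.mul_sum, hN']

/-- The letters of `U_{r+1}(X_i) B`, where a block `(i, r, B)` stands for this product. -/
def blockLetters (b : ι × ℕ × Matrix (Fin N) (Fin N) ℂ) : List (ι × Matrix (Fin N) (Fin N) ℂ) :=
  List.replicate b.2.1 (b.1, 1) ++ [(b.1, b.2.2)]

theorem blockLetters_ne_nil (b : ι × ℕ × Matrix (Fin N) (Fin N) ℂ) : blockLetters b ≠ [] := by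
  simp [blockLetters]

theorem head?_blockLetters_append (b : ι × ℕ × Matrix (Fin N) (Fin N) ℂ)
    (w : List (ι × Matrix (Fin N) (Fin N) ℂ)) :
    ∃ C, (blockLetters b ++ w).head? = some (b.1, C) := by
  obtain ⟨i, r, B⟩ := b
  rcases r with _ | r
  · exact ⟨B, rfl⟩
  · exact ⟨1, rfl⟩

/-- Inside a block the separating matrix is I with tr(I) = 1, giving the Chebyshev recursion of
variance 1. At its end `hw` removes the contraction. -/
theorem IsWickFamily.matrixWick_blockLetters_append {φ : 𝓐 →ₗ[ℂ] ℂ} (hN : 0 < N)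
    {T : ι → Matrix (Fin N) (Fin N) 𝓐} (hT : IsWickFamily φ T) (i : ι)
    (B : Matrix (Fin N) (Fin N) ℂ) (w : List (ι × Matrix (Fin N) (Fin N) ℂ))
    (hw : ∀ x ∈ w.head?, i = x.1 → ntr B = 0) : ∀ r : ℕ,
      matrixWick φ T (blockLetters (i, r, B) ++ w) =
        cheb 1 (T i) (r + 1) * const 𝓐 B * matrixWick φ T w
  | 0 => by
    rcases w with _ | ⟨⟨j, D⟩, w⟩
    · simp [blockLetters, cheb, matrixWick_singleton, matrixWick_nil]
    · have h : (open Classical in if i = j then ntr B else 0) = 0 := by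
        split_ifs with hij
        · exact hw _ rfl hij
        · rfl
      simp [blockLetters, cheb, hT.matrixWick_cons_cons, h]
  | 1 => by
    have h := hT.matrixWick_blockLetters_append hN i B w hw 0
    simp only [blockLetters, List.replicate_zero, List.nil_append, List.cons_append] at h
    simp only [blockLetters, List.replicate_succ, List.replicate_zero, List.nil_append,
      List.cons_append, hT.matrixWick_cons_cons i i, h, if_true, ntr_one hN, const_one, cheb]
    simp only [one_smul, mul_one, sub_mul, mul_assoc, one_mul]
  | r + 2 => by
    have h1 := hT.matrixWick_blockLetters_append hN i B w hw (r + 1)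
    have h0 := hT.matrixWick_blockLetters_append hN i B w hw r
    simp only [blockLetters, List.replicate_succ, List.append_assoc,
      List.cons_append, List.nil_append] at h1 h0
    simp only [blockLetters, List.replicate_succ, List.append_assoc,
      List.cons_append, List.nil_append, hT.matrixWick_cons_cons i i, h1, h0, if_true, ntr_one hN,
      const_one]
    rw [show cheb 1 (T i) (r + 2 + 1) =
      T i * cheb 1 (T i) (r + 1 + 1) - (1 : ℂ) • cheb 1 (T i) (r + 1) from rfl]
    simp only [one_smul, mul_one, sub_mul, mul_assoc, one_mul]

/-- No factor of a product of blocks contracts with its neighbour. -/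
def IsAlternating (v : List (ι × ℕ × Matrix (Fin N) (Fin N) ℂ)) : Prop :=
  v.IsChain (fun b b' => b.1 = b'.1 → ntr b.2.2 = 0) ∧ ∀ b ∈ v, ntr b.2.2 = 0 ∨ b.2.2 = 1

theorem IsAlternating.tail {b : ι × ℕ × Matrix (Fin N) (Fin N) ℂ}
    {v : List (ι × ℕ × Matrix (Fin N) (Fin N) ℂ)} (h : IsAlternating (b :: v)) :
    IsAlternating v :=
  ⟨h.1.tail, fun c hc => h.2 c (List.mem_cons_of_mem _ hc)⟩

theorem IsAlternating.head {b : ι × ℕ × Matrix (Fin N) (Fin N) ℂ}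
    {v : List (ι × ℕ × Matrix (Fin N) (Fin N) ℂ)} (h : IsAlternating (b :: v)) :
    ∀ x ∈ (v.flatMap blockLetters).head?, b.1 = x.1 → ntr b.2.2 = 0 := by
  rcases v with _ | ⟨c, v⟩
  · simp
  · obtain ⟨C, hC⟩ := head?_blockLetters_append c (v.flatMap blockLetters)
    rw [List.flatMap_cons, hC]
    rintro x hx
    obtain rfl : (c.1, C) = x := by simpa using hx
    exact h.1.rel

/-- The random matrix `U_{r+1}(T i) B`. -/
def blockValue (T : ι → Matrix (Fin N) (Fin N) 𝓐) (b : ι × ℕ × Matrix (Fin N) (Fin N) ℂ) :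
    Matrix (Fin N) (Fin N) 𝓐 :=
  cheb 1 (T b.1) (b.2.1 + 1) * const 𝓐 b.2.2

theorem IsWickFamily.matrixWick_flatMap_blockLetters {φ : 𝓐 →ₗ[ℂ] ℂ} (hN : 0 < N)
    {T : ι → Matrix (Fin N) (Fin N) 𝓐} (hT : IsWickFamily φ T)
    (v : List (ι × ℕ × Matrix (Fin N) (Fin N) ℂ)) (hv : IsAlternating v) :
    matrixWick φ T (v.flatMap blockLetters) =
      (v.map (blockValue T)).prod := by
  induction v with
  | nil => exact matrixWick_nil φ T
  | cons b v ih =>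
    rw [List.flatMap_cons, List.map_cons, List.prod_cons, ← ih hv.tail]
    exact hT.matrixWick_blockLetters_append hN b.1 b.2.2 _ hv.head b.2.1

/-! ### Orthogonality of blocks -/

/-- The covariance of two blocks. -/
def blockPairing (b c : ι × ℕ × Matrix (Fin N) (Fin N) ℂ) : ℂ :=
  open Classical in
    if b.1 = c.1 ∧ b.2.1 = c.2.1 then ntr (b.2.2.conjTranspose * c.2.2) else 0

/-- Equal letters I pair to 1 and are stripped off together. If one block ends first, its end matrix
is paired with I: the result is zero when that matrix is centered, and when it is I the next colour
in its word differs from the one still running in the other. -/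
theorem pairing_blockLetters_append (hN : 0 < N) (i j : ι) (A B : Matrix (Fin N) (Fin N) ℂ)
    (hA : ntr A = 0 ∨ A = 1) (hB : ntr B = 0 ∨ B = 1)
    (u v : List (ι × Matrix (Fin N) (Fin N) ℂ))
    (hu : ∀ x ∈ u.head?, i = x.1 → ntr A = 0) (hv : ∀ x ∈ v.head?, j = x.1 → ntr B = 0) :
    ∀ r r' : ℕ, pairing letterPairing (blockLetters (i, r, A) ++ u)
      (blockLetters (j, r', B) ++ v) =
        blockPairing (i, r, A) (j, r', B) * pairing letterPairing u v := by
  have h1 : ntr (1 : Matrix (Fin N) (Fin N) ℂ) = 1 := ntr_one hN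
  by_cases hij : i = j
  · subst hij
    intro r
    induction r with
    | zero =>
      intro r'
      rcases r' with _ | r'
      · simp [blockLetters, pairing, letterPairing, blockPairing]
      · simp only [blockLetters, List.replicate_zero, List.nil_append, List.replicate_succ,
          List.cons_append, List.append_assoc, pairing, letterPairing, if_true, mul_one,
          ntr_conjTranspose, blockPairing, true_and]
        rw [if_neg (by omega), zero_mul]
        rcases hA with hA | hA
        · rw [hA, star_zero, zero_mul]
        · have hu' : ∀ x ∈ u.head?, i ≠ x.1 := fun x hx hix => by
            have := hu x hx hix
            rw [hA, h1] at this
            exact one_ne_zero this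
          obtain ⟨C, hC⟩ := head?_blockLetters_append (i, r', B) v
          simp only [blockLetters, List.append_assoc, List.cons_append, List.nil_append] at hC
          obtain ⟨y, w, hw⟩ : ∃ y w, List.replicate r' (i, 1) ++ (i, B) :: v = y :: w :=
            List.exists_cons_of_ne_nil (by simp)
          rw [hw] at hC ⊢
          rcases u with _ | ⟨x, u⟩
          · simp [pairing]
          · have hy : y = (i, C) := by simpa using hC
            have hx : x.1 ≠ i := (hu' x rfl).symm
            simp [pairing, letterPairing, hy, hx]
    | succ r ih =>
      intro r'
      rcases r' with _ | r'
      · simp only [blockLetters, List.replicate_zero, List.nil_append, List.replicate_succ,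
          List.cons_append, List.append_assoc, pairing, letterPairing, if_true, one_mul,
          Matrix.conjTranspose_one, blockPairing, true_and]
        rw [if_neg (by omega), zero_mul]
        rcases hB with hB | hB
        · rw [hB, zero_mul]
        · have hv' : ∀ x ∈ v.head?, i ≠ x.1 := fun x hx hix => by
            have := hv x hx hix
            rw [hB, h1] at this
            exact one_ne_zero this
          obtain ⟨C, hC⟩ := head?_blockLetters_append (i, r, A) u
          simp only [blockLetters, List.append_assoc, List.cons_append, List.nil_append] at hC
          obtain ⟨y, w, hw⟩ : ∃ y w, List.replicate r (i, 1) ++ (i, A) :: u = y :: w :=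
            List.exists_cons_of_ne_nil (by simp)
          rw [hw] at hC ⊢
          rcases v with _ | ⟨x, v⟩
          · simp [pairing]
          · have hy : y = (i, C) := by simpa using hC
            have hx : i ≠ x.1 := hv' x rfl
            simp [pairing, letterPairing, hy, hx]
      · have := ih r'
        simp only [blockLetters, List.append_assoc, List.cons_append, List.nil_append, blockPairing,
          true_and] at this
        simp only [blockLetters, List.replicate_succ, List.cons_append, List.append_assoc, List.nil_append,
          pairing, letterPairing, if_true, Matrix.conjTranspose_one, mul_one, h1, one_mul, this,
          blockPairing, true_and, add_left_inj]
  · intro r r'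
    have : ∀ C D : Matrix (Fin N) (Fin N) ℂ, letterPairing (i, C) (j, D) = 0 := fun C D => by
      simp [letterPairing, hij]
    rcases r with _ | r <;> rcases r' with _ | r' <;>
      simp [blockLetters, List.replicate_succ, pairing, this, blockPairing, hij]

theorem pairing_flatMap_blockLetters (hN : 0 < N) :
    ∀ u v : List (ι × ℕ × Matrix (Fin N) (Fin N) ℂ), IsAlternating u → IsAlternating v →
      pairing letterPairing (u.flatMap blockLetters) (v.flatMap blockLetters) =
        pairing blockPairing u v
  | [], [], _, _ => rfl
  | [], c :: v, _, _ => by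
    obtain ⟨y, w, hw⟩ := List.exists_cons_of_ne_nil
      (List.append_ne_nil_of_left_ne_nil (blockLetters_ne_nil c) (v.flatMap blockLetters))
    rw [List.flatMap_nil, List.flatMap_cons, hw]
    rfl
  | b :: u, [], _, _ => by
    obtain ⟨y, w, hw⟩ := List.exists_cons_of_ne_nil
      (List.append_ne_nil_of_left_ne_nil (blockLetters_ne_nil b) (u.flatMap blockLetters))
    rw [List.flatMap_nil, List.flatMap_cons, hw]
    rfl
  | b :: u, c :: v, hu, hv => by
    rw [List.flatMap_cons, List.flatMap_cons, pairing,
      ← pairing_flatMap_blockLetters hN u v hu.tail hv.tail]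
    exact pairing_blockLetters_append hN b.1 c.1 b.2.2 c.2.2 (hu.2 b (by simp)) (hv.2 c (by simp))
      _ _ hu.head hv.head b.2.1 c.2.1

/-- The covariance of traces of alternating products of Chebyshev polynomials. -/
theorem IsWickFamily.map_star_trace_prod_mul {φ : 𝓐 →ₗ[ℂ] ℂ} (hφ : IsState φ) (hN : 0 < N)
    {T : ι → Matrix (Fin N) (Fin N) 𝓐} (hT : IsWickFamily φ T)
    (u v : List (ι × ℕ × Matrix (Fin N) (Fin N) ℂ)) (hu : IsAlternating u) (hv : IsAlternating v)
    (huv : u ≠ [] ∨ v ≠ []) :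
    φ (star (u.map (blockValue T)).prod.trace * (v.map (blockValue T)).prod.trace) =
        pairing blockPairing u v := by
  rw [← hT.matrixWick_flatMap_blockLetters hN u hu, ← hT.matrixWick_flatMap_blockLetters hN v hv,
    ← pairing_flatMap_blockLetters hN u v hu hv]
  refine hT.map_star_trace_mul hφ _ _ (huv.imp ?_ ?_) <;>
  · intro h h'
    rw [List.flatMap_eq_nil_iff] at h'
    obtain ⟨b, w, rfl⟩ := List.exists_cons_of_ne_nil h
    exact blockLetters_ne_nil b (h' b (by simp))

theorem isAlternating_singleton (i : ι) (r : ℕ) :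
    IsAlternating [(i, r, (1 : Matrix (Fin N) (Fin N) ℂ))] :=
  ⟨by simp, by simp⟩

-- One-block words ending in I make Chebyshev polynomials of positive degree orthonormal for tr ⊗ φ.
-- This later identifies the block covariance with tr(Pₜ Qₜ).
open Classical in
theorem IsWickFamily.ntrState_cheb_mul_cheb {φ : 𝓐 →ₗ[ℂ] ℂ} (hφ : IsState φ) (hN : 0 < N)
    {T : ι → Matrix (Fin N) (Fin N) 𝓐} (hT : IsWickFamily φ T) (i j : ι) (r r' : ℕ) :
    ntrState φ ((cheb 1 (T i) (r + 1)).conjTranspose * cheb 1 (T j) (r' + 1)) =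
      if i = j ∧ r = r' then 1 else 0 := by
  have h := fun (i : ι) (r : ℕ) => hT.matrixWick_flatMap_blockLetters hN _
    (isAlternating_singleton i r)
  simp only [List.map_cons, List.map_nil, List.prod_singleton, blockValue, const_one, mul_one] at h
  rw [← h, ← h, hT.ntrState_conjTranspose_mul hφ hN _ _ (by simp [blockLetters]),
    pairing_flatMap_blockLetters hN _ _ (isAlternating_singleton i r)
      (isAlternating_singleton j r')]
  simp [pairing, blockPairing, ntr_one hN]

theorem IsWickFamily.ntrState_cheb {φ : 𝓐 →ₗ[ℂ] ℂ} (hφ : IsState φ) (hN : 0 < N)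
    {T : ι → Matrix (Fin N) (Fin N) 𝓐} (hT : IsWickFamily φ T) (i : ι) (r : ℕ) :
    ntrState φ (cheb 1 (T i) (r + 1)) = 0 := by
  have h := hT.matrixWick_flatMap_blockLetters hN _ (isAlternating_singleton i r)
  simp only [List.map_cons, List.map_nil, List.prod_singleton, blockValue, const_one, mul_one] at h
  have h' := hT.ntrState_conjTranspose_mul hφ hN [] ([(i, r, 1)].flatMap blockLetters)
    (by simp [blockLetters])
  rw [matrixWick_nil, Matrix.conjTranspose_one, one_mul, h] at h'
  rw [h']
  exact pairing_flatMap_blockLetters hN [] [(i, r, 1)] ⟨by simp, by simp⟩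
    (isAlternating_singleton i r)

theorem IsWickFamily.centeredPower_mem_span {φ : 𝓐 →ₗ[ℂ] ℂ} (hφ : IsState φ) (hN : 0 < N)
    {T : ι → Matrix (Fin N) (Fin N) 𝓐} (hT : IsWickFamily φ T) (i : ι) (k : ℕ) :
    centeredPower φ (T i) k ∈
      Submodule.span ℂ (Set.range fun r : ℕ => cheb 1 (T i) (r + 1)) := by
  obtain ⟨c, hc⟩ := exists_pow_sub_mem_span_cheb 1 (T i) k
  -- The span is centered, so the scalar `c` must be the trace of the power, which is the one
  -- subtracted in `centeredPower`.
  have h0 : ntrStateLinear φ (T i ^ k - c • (1 : Matrix (Fin N) (Fin N) 𝓐)) = 0 := by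
    have hle : Submodule.span ℂ (Set.range fun r : ℕ => cheb 1 (T i) (r + 1)) ≤
        LinearMap.ker (ntrStateLinear φ) := by
      rw [Submodule.span_le]
      rintro _ ⟨r, rfl⟩
      exact hT.ntrState_cheb hφ hN i r
    exact hle hc
  rw [map_sub, map_smul, ntrStateLinear_apply, ntrStateLinear_apply, ntrState_one hφ.map_one hN,
    smul_eq_mul, mul_one, sub_eq_zero] at h0
  rwa [centeredPower, h0]

end FreeTrace

namespace FreeTrace

/-! ### Multilinear extension -/

/-- The slots are enlarged from generators to their span one at a time; `s` is the set of slots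
already enlarged. -/
theorem multilinearMap_eq_of_mem_span {κ E F : Type*} [Fintype κ] [AddCommGroup E] [Module ℂ E]
    [AddCommGroup F] [Module ℂ F] (f g : MultilinearMap ℂ (fun _ : κ => E) F) (M : κ → Set E)
    (h : ∀ x : κ → E, (∀ i, x i ∈ M i) → f x = g x) (x : κ → E)
    (hx : ∀ i, x i ∈ Submodule.span ℂ (M i)) : f x = g x := by
  classical
  have key : ∀ s : Finset κ, ∀ x : κ → E, (∀ i ∈ s, x i ∈ Submodule.span ℂ (M i)) →
      (∀ i ∉ s, x i ∈ M i) → f x = g x := by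
    intro s
    induction s using Finset.induction_on with
    | empty => exact fun x _ hx => h x fun i => hx i (Finset.notMem_empty i)
    | insert i s his ih =>
      intro x hx hx'
      have hy : ∀ y ∈ Submodule.span ℂ (M i),
          f (Function.update x i y) = g (Function.update x i y) := by
        intro y hy
        induction hy using Submodule.span_induction with
        | mem y hy =>
          refine ih _ (fun t ht => ?_) fun t ht => ?_
          · rw [Function.update_of_ne (by rintro rfl; exact his ht)]
            exact hx t (Finset.mem_insert_of_mem ht)
          · by_cases hti : t = i
            · subst hti
              simpa using hy
            · rw [Function.update_of_ne hti]
              exact hx' t (by simp [hti, ht])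
        | zero => rw [f.map_update_zero, g.map_update_zero]
        | add y z _ _ hy hz => rw [f.map_update_add, g.map_update_add, hy, hz]
        | smul c y _ hy => rw [f.map_update_smul, g.map_update_smul, hy]
      simpa using hy (x i) (hx i (Finset.mem_insert_self i s))
  exact key Finset.univ x (fun i _ => hx i) fun i hi => absurd (Finset.mem_univ i) hi

variable {𝓐 : Type*} [CStarAlgebra 𝓐] {N : ℕ} {ι : Type*}

theorem map_mul_trace_prod_eq_of_mem_span (φ : 𝓐 →ₗ[ℂ] ℂ) (c : 𝓐) {n : ℕ}
    (B : Fin n → Matrix (Fin N) (Fin N) ℂ) (g : Fin n → Matrix (Fin N) (Fin N) 𝓐 →ₗ[ℂ] ℂ) (d : ℂ)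
    (M : Fin n → Set (Matrix (Fin N) (Fin N) 𝓐))
    (h : ∀ q : Fin n → Matrix (Fin N) (Fin N) 𝓐, (∀ t, q t ∈ M t) →
      φ (c * (List.ofFn fun t => q t * const 𝓐 (B t)).prod.trace) = d * ∏ t, g t (q t))
    (q : Fin n → Matrix (Fin N) (Fin N) 𝓐) (hq : ∀ t, q t ∈ Submodule.span ℂ (M t)) :
    φ (c * (List.ofFn fun t => q t * const 𝓐 (B t)).prod.trace) = d * ∏ t, g t (q t) := by
  let F : MultilinearMap ℂ (fun _ : Fin n => Matrix (Fin N) (Fin N) 𝓐) ℂ :=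
    (φ ∘ₗ LinearMap.mulLeft ℂ c ∘ₗ Matrix.traceLinearMap (Fin N) ℂ 𝓐).compMultilinearMap
      ((MultilinearMap.mkPiAlgebraFin ℂ n (Matrix (Fin N) (Fin N) 𝓐)).compLinearMap
        fun t => LinearMap.mulRight ℂ (const 𝓐 (B t)))
  let G : MultilinearMap ℂ (fun _ : Fin n => Matrix (Fin N) (Fin N) 𝓐) ℂ :=
    d • (MultilinearMap.mkPiAlgebra ℂ (Fin n) ℂ).compLinearMap g
  have hF : ∀ q, F q = φ (c * (List.ofFn fun t => q t * const 𝓐 (B t)).prod.trace) := fun q => by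
    simp [F]
  have hG : ∀ q, G q = d * ∏ t, g t (q t) := fun q => by simp [G]
  rw [← hF, ← hG]
  exact multilinearMap_eq_of_mem_span F G M (fun x hx => by rw [hF, hG]; exact h x hx) q hq

/-! ### The covariance of traces of alternating products -/

theorem pairing_ofFn {X : Type*} (g : X → X → ℂ) : ∀ {n : ℕ} (u v : Fin n → X),
    pairing g (List.ofFn u) (List.ofFn v) = ∏ t, g (u t) (v t)
  | 0, _, _ => by simp [pairing]
  | n + 1, u, v => by
    rw [List.ofFn_succ, List.ofFn_succ, pairing, pairing_ofFn, Fin.prod_univ_succ]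

theorem pairing_eq_zero_of_length_ne {X : Type*} (g : X → X → ℂ) : ∀ u v : List X,
    u.length ≠ v.length → pairing g u v = 0
  | [], [], h => absurd rfl h
  | x :: u, y :: v, h => by
    rw [pairing, pairing_eq_zero_of_length_ne g u v (by simpa using h), mul_zero]
  | [], _ :: _, _ => rfl
  | _ :: _, [], _ => rfl

/-- The conditions on the colours `s` and the constant matrices `A` of an alternating product. -/
def IsAdmissible {n : ℕ} (s : Fin n → ι) (A : Fin n → Matrix (Fin N) (Fin N) ℂ) : Prop :=
  (∀ (t : ℕ) (h : t + 1 < n), s ⟨t, by omega⟩ = s ⟨t + 1, h⟩ → ntr (A ⟨t, by omega⟩) = 0) ∧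
    ∀ t, ntr (A t) = 0 ∨ A t = 1

theorem IsAdmissible.isAlternating {n : ℕ} {s : Fin n → ι} {A : Fin n → Matrix (Fin N) (Fin N) ℂ}
    (h : IsAdmissible s A) (r : Fin n → ℕ) :
    IsAlternating (List.ofFn fun t => (s t, r t, A t)) := by
  constructor
  · rw [List.isChain_iff_getElem]
    intro i hi
    simpa using h.1 i (by simpa using hi)
  · intro b hb
    obtain ⟨t, rfl⟩ := (List.mem_ofFn' _ _).1 hb
    exact h.2 t

/-- The span of the Chebyshev polynomials of positive degree in `X`. -/
abbrev chebSpan (X : Matrix (Fin N) (Fin N) 𝓐) : Submodule ℂ (Matrix (Fin N) (Fin N) 𝓐) :=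
  Submodule.span ℂ (Set.range fun r : ℕ => cheb 1 X (r + 1))

section Covariance

variable {φ : 𝓐 →ₗ[ℂ] ℂ} {T : ι → Matrix (Fin N) (Fin N) 𝓐} {n m : ℕ} {s : Fin n → ι} {j : Fin m → ι}
  {A : Fin n → Matrix (Fin N) (Fin N) ℂ} {B : Fin m → Matrix (Fin N) (Fin N) ℂ}

theorem IsState.map_star_mul_comm (hφ : IsState φ) (x y : 𝓐) :
    φ (star x * y) = star (φ (star y * x)) := by
  rw [← hφ.map_star, star_mul, star_star]

theorem IsWickFamily.map_star_trace_ofFn_mul_cheb (hφ : IsState φ) (hN : 0 < N)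
    (hT : IsWickFamily φ T) (hs : IsAdmissible s A) (hj : IsAdmissible j B) (hm : 0 < m)
    (a : Fin n → ℕ) (b : Fin m → ℕ) :
    φ (star (List.ofFn fun t => cheb 1 (T (s t)) (a t + 1) * const 𝓐 (A t)).prod.trace *
      (List.ofFn fun t => cheb 1 (T (j t)) (b t + 1) * const 𝓐 (B t)).prod.trace) =
        pairing blockPairing (List.ofFn fun t => (s t, a t, A t))
          (List.ofFn fun t => (j t, b t, B t)) := by
  have := hT.map_star_trace_prod_mul hφ hN _ _ (hs.isAlternating a) (hj.isAlternating b)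
    (Or.inr (by simp; omega))
  simpa [List.map_ofFn, Function.comp_def, blockValue] using this

/-- Products of different lengths are uncorrelated. -/
theorem IsWickFamily.map_star_trace_ofFn_mul_of_ne (hφ : IsState φ) (hN : 0 < N)
    (hT : IsWickFamily φ T) (hs : IsAdmissible s A) (hj : IsAdmissible j B) (hm : 0 < m)
    (hnm : n ≠ m) {p : Fin n → Matrix (Fin N) (Fin N) 𝓐} {q : Fin m → Matrix (Fin N) (Fin N) 𝓐}
    (hp : ∀ t, p t ∈ chebSpan (T (s t))) (hq : ∀ t, q t ∈ chebSpan (T (j t))) :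
    φ (star (List.ofFn fun t => p t * const 𝓐 (A t)).prod.trace *
      (List.ofFn fun t => q t * const 𝓐 (B t)).prod.trace) = 0 := by
  rw [hφ.map_star_mul_comm, star_eq_zero]
  refine (map_mul_trace_prod_eq_of_mem_span φ _ A (fun _ => 0) 0 _ (fun p hp => ?_) p hp).trans
    (zero_mul _)
  rw [hφ.map_star_mul_comm, zero_mul, star_eq_zero]
  refine (map_mul_trace_prod_eq_of_mem_span φ _ B (fun _ => 0) 0 _ (fun q hq => ?_) q hq).trans
    (zero_mul _)
  choose a ha using hp
  choose b hb using hq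
  simp only [← ha, ← hb]
  rw [hT.map_star_trace_ofFn_mul_cheb hφ hN hs hj hm, zero_mul]
  exact pairing_eq_zero_of_length_ne _ _ _ (by simpa using hnm)

/-- The expression is conjugate-linear in `p`. Conjugating the identity exchanges the two sides, so
the linear extension applies to `p`; conjugating back allows it for `q`, and orthonormality settles
the Chebyshev case. -/
theorem IsWickFamily.map_star_trace_ofFn_mul (hφ : IsState φ) (hN : 0 < N)
    (hT : IsWickFamily φ T) {j : Fin n → ι} {B : Fin n → Matrix (Fin N) (Fin N) ℂ}
    (hs : IsAdmissible s A) (hj : IsAdmissible j B) (hn : 0 < n)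
    {p q : Fin n → Matrix (Fin N) (Fin N) 𝓐}
    (hp : ∀ t, p t ∈ chebSpan (T (s t))) (hq : ∀ t, q t ∈ chebSpan (T (j t))) :
    φ (star (List.ofFn fun t => p t * const 𝓐 (A t)).prod.trace *
      (List.ofFn fun t => q t * const 𝓐 (B t)).prod.trace) =
        ∏ t, ntr ((A t).conjTranspose * B t) * ntrState φ ((p t).conjTranspose * q t) := by
  have hstar : ∀ (p q : Matrix (Fin N) (Fin N) 𝓐) (A B : Matrix (Fin N) (Fin N) ℂ),
      star (ntr (A.conjTranspose * B) * ntrState φ (p.conjTranspose * q)) =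
        ntr (B.conjTranspose * A) * ntrState φ (q.conjTranspose * p) := fun p q A B => by
    rw [star_mul', ← ntr_conjTranspose, ← ntrState_conjTranspose hφ, Matrix.conjTranspose_mul,
      Matrix.conjTranspose_mul, Matrix.conjTranspose_conjTranspose,
      Matrix.conjTranspose_conjTranspose]
  let g : Matrix (Fin N) (Fin N) ℂ → Matrix (Fin N) (Fin N) 𝓐 → Matrix (Fin N) (Fin N) 𝓐 →ₗ[ℂ] ℂ :=
    fun C x => ntr C • (ntrStateLinear φ ∘ₗ LinearMap.mulLeft ℂ x.conjTranspose)
  have hg : ∀ C x y, g C x y = ntr C * ntrState φ (x.conjTranspose * y) := fun C x y => rfl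
  rw [hφ.map_star_mul_comm, ← star_star (∏ t, _), star_prod]
  simp only [hstar]
  refine congrArg star ?_
  have h1 := map_mul_trace_prod_eq_of_mem_span φ
    (star (List.ofFn fun t => q t * const 𝓐 (B t)).prod.trace) A
    (fun t => g ((B t).conjTranspose * A t) (q t)) 1 _ (fun p hp => ?_) p hp
  · simpa only [hg, one_mul] using h1
  simp only [hg, one_mul]
  rw [hφ.map_star_mul_comm, ← star_star (∏ t, _), star_prod]
  simp only [hstar]
  refine congrArg star ?_
  have h2 := map_mul_trace_prod_eq_of_mem_span φ
    (star (List.ofFn fun t => p t * const 𝓐 (A t)).prod.trace) B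
    (fun t => g ((A t).conjTranspose * B t) (p t)) 1 _ (fun q hq => ?_) q hq
  · simpa only [hg, one_mul] using h2
  choose a ha using hp
  choose b hb using hq
  simp only [hg, one_mul, ← ha, ← hb]
  rw [hT.map_star_trace_ofFn_mul_cheb hφ hN hs hj hn, pairing_ofFn]
  refine Finset.prod_congr rfl fun t _ => ?_
  rw [hT.ntrState_cheb_mul_cheb hφ hN, blockPairing, mul_ite, mul_one, mul_zero]

end Covariance

/-! ### Semicircular ensembles -/

/-- Entries below the diagonal are adjoints of those above it, and diagonal entries have no
imaginary part. -/
theorem entry_mem_span_entryPart {X : Matrix (Fin N) (Fin N) 𝓐} (hX : X.conjTranspose = X)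
    (p q : Fin N) : X p q ∈ Submodule.span ℂ (Set.range (entryPart X)) := by
  have hst : ∀ p q, star (X p q) = X q p := fun p q => by
    rw [← Matrix.conjTranspose_apply, hX]
  have hupper : ∀ p q, p ≤ q → X p q ∈ Submodule.span ℂ (Set.range (entryPart X)) ∧
      X q p ∈ Submodule.span ℂ (Set.range (entryPart X)) := by
    intro p q hpq
    have hre : ((ℜ (X p q) : selfAdjoint 𝓐) : 𝓐) ∈ Submodule.span ℂ (Set.range (entryPart X)) :=
      Submodule.subset_span ⟨Sum.inl ⟨(p, q), hpq⟩, rfl⟩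
    have him : ((ℑ (X p q) : selfAdjoint 𝓐) : 𝓐) ∈ Submodule.span ℂ (Set.range (entryPart X)) := by
      rcases hpq.lt_or_eq with hlt | rfl
      · exact Submodule.subset_span ⟨Sum.inr ⟨(p, q), hlt⟩, rfl⟩
      · have : IsSelfAdjoint (X p p) := hst p p
        rw [this.imaginaryPart]
        exact zero_mem _
    have e := realPart_add_I_smul_imaginaryPart (X p q)
    constructor
    · rw [← e]
      exact add_mem hre (Submodule.smul_mem _ _ him)
    · rw [← hst, ← e, star_add, star_smul, (ℜ (X p q)).2.star_eq, (ℑ (X p q)).2.star_eq]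
      exact add_mem hre (Submodule.smul_mem _ _ him)
  rcases le_total p q with h | h
  · exact (hupper p q h).1
  · exact (hupper q p h).2

/-- Freeness and semicircularity are known for real and imaginary parts only; Wick words in the
entries are reached from them by multilinearity. -/
theorem IsSemicircularEnsemble.isWickFamily {φ : 𝓐 →ₗ[ℂ] ℂ} (hφ : IsState φ) {𝓗 : Type*}
    [NormedAddCommGroup 𝓗] [InnerProductSpace ℂ 𝓗] {V : Set 𝓗}
    {S : 𝓗 → Matrix (Fin N) (Fin N) 𝓐} (hS : IsSemicircularEnsemble φ V S) {f : ι → 𝓗}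
    (hf : Orthonormal ℂ f) (hfV : ∀ i, f i ∈ V) : IsWickFamily φ fun i => S (f i) where
  covariance i j p q r t := by
    classical
    rw [hS.covariance _ (hfV i) _ (hfV j), orthonormal_iff_ite.1 hf i j]
    by_cases hij : i = j <;> simp [hij]
  star_apply i p q := by
    rw [← Matrix.conjTranspose_apply, hS.selfAdjoint _ (hfV i)]
  map_wick w hw := by
    have hE := hS.free (Set.range f) (by rintro _ ⟨i, rfl⟩; exact hfV i)
      (by rintro ⟨i, hi⟩; exact hf.ne_zero i hi) (by
        rintro _ ⟨i, rfl⟩ _ ⟨j, rfl⟩ hne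
        exact hf.2 fun h => hne (h ▸ rfl))
    refine map_wick_eq_zero_of_mem_span φ
      (Y := Set.range fun p : Set.range f × EntryIndex N => entryPart (S p.1.1) p.2)
      (fun v hv hvY => ?_) _ (fun a ha => ?_) [] (by simp) (by simpa using hw)
    · obtain ⟨v, rfl⟩ : v ∈ Set.range (List.map fun p : Set.range f × EntryIndex N =>
          entryPart (S p.1.1) p.2) := by
        rw [Set.range_list_map]
        exact hvY
      refine map_wick_eq_zero_of_free hφ.map_one (fun x => ?_) hE v (by simpa using hv)
      obtain ⟨⟨_, i, rfl⟩, e⟩ := x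
      exact hS.semicircular _ (hfV i) (hf.ne_zero i) e
    · obtain ⟨x, -, rfl⟩ := List.mem_map.1 ha
      refine Submodule.span_mono ?_
        (entry_mem_span_entryPart (hS.selfAdjoint _ (hfV x.1)) x.2.1 x.2.2)
      rintro _ ⟨e, rfl⟩
      exact ⟨(⟨f x.1, x.1, rfl⟩, e), rfl⟩

/-! ### Second cumulants -/

theorem freeCumulant_one (φ : 𝓐 →ₗ[ℂ] ℂ) (a : Fin 1 → 𝓐) : freeCumulant φ 1 a = φ (a 0) := by
  have h : properNC 1 = ∅ := by
    refine Finset.eq_empty_of_forall_notMem fun π hπ => ?_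
    obtain ⟨B, hB, -⟩ := π.existsUnique_mem (Finset.mem_univ 0)
    have h1 := card_lt_of_mem_properNC hπ hB.1
    have h2 := Finset.card_pos.2 (π.nonempty_of_mem_parts hB.1)
    omega
  rw [freeCumulant]
  have : IsEmpty {π // π ∈ properNC 1} := ⟨fun π => by simpa [h] using π.2⟩
  simp

theorem freeCumulant_of_card_eq_one (φ : 𝓐 →ₗ[ℂ] ℂ) {n : ℕ} (a : Fin n → 𝓐) {B : Finset (Fin n)}
    (hB : B.card = 1) :
    freeCumulant φ B.card (fun i => a (B.orderEmbOfFin rfl i)) = ∏ x ∈ B, φ (a x) := by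
  have h : ∀ {m : ℕ} (hm : m = 1) (c : Fin m → 𝓐),
      freeCumulant φ m c = φ (c ⟨0, by omega⟩) := by
    rintro _ rfl c
    exact freeCumulant_one φ c
  obtain ⟨x, rfl⟩ := Finset.card_eq_one.1 hB
  rw [h hB, Finset.prod_singleton]
  exact congrArg (fun z => φ (a z)) (Finset.mem_singleton.1 (Finset.orderEmbOfFin_mem _ rfl _))

theorem card_eq_one_of_mem_properNC_two {π : Finpartition (Finset.univ : Finset (Fin 2))}
    (hπ : π ∈ properNC 2) {B : Finset (Fin 2)} (hB : B ∈ π.parts) : B.card = 1 := by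
  have h1 := card_lt_of_mem_properNC hπ hB
  have h2 := Finset.card_pos.2 (π.nonempty_of_mem_parts hB)
  omega

theorem properNC_two : properNC 2 = {⊥} := by
  rw [Finset.eq_singleton_iff_unique_mem]
  constructor
  · simp only [properNC, Finset.mem_filter, Finset.mem_univ, true_and]
    constructor
    · rintro B - D - - ⟨i, j, k, l, hij, hjk, -⟩
      omega
    · intro h
      have : ({0} : Finset (Fin 2)) ∈ (⊥ : Finpartition (Finset.univ : Finset (Fin 2))).parts :=
        Finpartition.mem_bot_iff.2 ⟨0, Finset.mem_univ _, rfl⟩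
      rw [h, Finset.mem_singleton] at this
      have := congrArg Finset.card this
      simp at this
  · intro π hπ
    ext B
    rw [Finpartition.mem_bot_iff]
    constructor
    · intro hB
      obtain ⟨x, rfl⟩ := Finset.card_eq_one.1 (card_eq_one_of_mem_properNC_two hπ hB)
      exact ⟨x, Finset.mem_univ _, rfl⟩
    · rintro ⟨x, -, rfl⟩
      obtain ⟨D, ⟨hD, hxD⟩, -⟩ := π.existsUnique_mem (Finset.mem_univ x)
      obtain ⟨y, rfl⟩ := Finset.card_eq_one.1 (card_eq_one_of_mem_properNC_two hπ hD)
      rwa [Finset.mem_singleton.1 hxD]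

/-- The only proper non-crossing partition of two points is the one into singletons, whose cumulants
are means. -/
theorem freeCumulant_two (φ : 𝓐 →ₗ[ℂ] ℂ) (a b : 𝓐) :
    freeCumulant φ 2 ![a, b] = φ (a * b) - φ a * φ b := by
  rw [freeCumulant]
  have h : ∀ π : {π // π ∈ properNC 2}, (∏ B : {B // B ∈ π.1.parts},
      freeCumulant φ B.1.card (fun i => ![a, b] (B.1.orderEmbOfFin rfl i))) = φ a * φ b := by
    rintro ⟨π, hπ⟩
    rw [Finset.prod_congr rfl fun B _ => freeCumulant_of_card_eq_one φ ![a, b]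
      (card_eq_one_of_mem_properNC_two hπ B.2),
      Finset.prod_coe_sort π.parts (fun B => ∏ x ∈ B, φ (![a, b] x))]
    have := Finset.prod_biUnion (t := id) (f := fun x => φ (![a, b] x)) π.disjoint
    rw [π.biUnion_parts, Fin.prod_univ_two] at this
    exact this.symm
  rw [Finset.sum_congr rfl fun π _ => h π, Finset.sum_const, Finset.card_univ,
    Fintype.card_coe, properNC_two, Finset.card_singleton, one_smul]
  simp [List.ofFn_succ]

end FreeTrace

end

/-! ### The covariance formula -/

open FreeTrace

theorem lemma3p5
    {𝓐 : Type*} [CStarAlgebra 𝓐] (φ : 𝓐 →ₗ[ℂ] ℂ) (hφ : FreeTrace.IsState φ)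
    {𝓗 : Type*} [NormedAddCommGroup 𝓗] [InnerProductSpace ℂ 𝓗] [CompleteSpace 𝓗]
    {N : ℕ} (hN : 0 < N)
    (V : Set 𝓗) (S : 𝓗 → Matrix (Fin N) (Fin N) 𝓐)
    (hS : FreeTrace.IsSemicircularEnsemble φ V S)
    {ι : Type*} (f : ι → 𝓗) (hf : Orthonormal ℂ f) (hfV : ∀ i, f i ∈ V)
    {n m : ℕ} (hn : 0 < n) (hm : 0 < m)
    (s : Fin n → ι) (j : Fin m → ι)
    (k : Fin n → ℕ) (hk : ∀ t, 0 < k t) (l : Fin m → ℕ) (hl : ∀ t, 0 < l t)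
    (A : Fin n → Matrix (Fin N) (Fin N) ℂ) (B : Fin m → Matrix (Fin N) (Fin N) ℂ)
    (hA : ∀ t, FreeTrace.ntr (A t) = 0 ∨ A t = 1)
    (hB : ∀ t, FreeTrace.ntr (B t) = 0 ∨ B t = 1)
    (hAs : ∀ (t : ℕ) (h : t + 1 < n), s ⟨t, by omega⟩ = s ⟨t + 1, h⟩ → A ⟨t, by omega⟩ ≠ 1)
    (hBj : ∀ (t : ℕ) (h : t + 1 < m), j ⟨t, by omega⟩ = j ⟨t + 1, h⟩ → B ⟨t, by omega⟩ ≠ 1)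
    (P : Fin n → Matrix (Fin N) (Fin N) 𝓐) (Q : Fin m → Matrix (Fin N) (Fin N) 𝓐)
    (hP : ∀ t, P t = FreeTrace.centeredPower φ (S (f (s t))) (k t))
    (hQ : ∀ t, Q t = FreeTrace.centeredPower φ (S (f (j t))) (l t)) :
    FreeTrace.freeCumulant φ 2
        ![(List.ofFn fun t => FreeTrace.const 𝓐 (A t) * P t).reverse.prod.trace,
          (List.ofFn fun t => Q t * FreeTrace.const 𝓐 (B t)).prod.trace] =
      if h : n = m then
        ∏ t : Fin n, FreeTrace.ntr (A t * B (Fin.cast h t)) *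
          FreeTrace.ntrState φ (P t * Q (Fin.cast h t))
      else 0 := by
  have hT := hS.isWickFamily hφ hf hfV
  -- The adjoint of the first argument places A_t* between P_t and P_{t+1}, so admissibility is
  -- needed for the adjoints in the original order.
  have hsA : IsAdmissible s fun t => (A t).conjTranspose := by
    refine ⟨fun t h hst => ?_, fun t => ?_⟩
    · rw [ntr_conjTranspose, (hA _).resolve_right (hAs t h hst), star_zero]
    · rcases hA t with h | h
      · exact Or.inl (by rw [ntr_conjTranspose, h, star_zero])
      · exact Or.inr (by simp only [h, Matrix.conjTranspose_one])
  have hjB : IsAdmissible j B := ⟨fun t h hst => (hB _).resolve_right (hBj t h hst), hB⟩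
  have hPmem : ∀ t, P t ∈ chebSpan (S (f (s t))) := fun t => by
    rw [hP]; exact hT.centeredPower_mem_span hφ hN (s t) (k t)
  have hQmem : ∀ t, Q t ∈ chebSpan (S (f (j t))) := fun t => by
    rw [hQ]; exact hT.centeredPower_mem_span hφ hN (j t) (l t)
  have hPstar : ∀ t, (P t).conjTranspose = P t := fun t => by
    have hX : (S (f (s t)) ^ k t).conjTranspose = S (f (s t)) ^ k t := by
      rw [Matrix.conjTranspose_pow, hS.selfAdjoint _ (hfV _)]
    rw [hP, centeredPower, Matrix.conjTranspose_sub, Matrix.conjTranspose_smul, hX,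
      ← ntrState_conjTranspose hφ, hX, Matrix.conjTranspose_one]
  have hY : (List.ofFn fun t => const 𝓐 (A t) * P t).reverse.prod.trace =
      star (List.ofFn fun t => P t * const 𝓐 (A t).conjTranspose).prod.trace := by
    rw [← Matrix.trace_conjTranspose, Matrix.conjTranspose_list_prod, List.map_ofFn]
    simp only [Function.comp_def, Matrix.conjTranspose_mul, conjTranspose_const, hPstar,
      Matrix.conjTranspose_conjTranspose]
  -- Correlation with the empty product, whose trace is N · 1: since `m` is positive the lengths
  -- differ, and N times the mean vanishes.
  have hQ0 : φ (List.ofFn fun t => Q t * const 𝓐 (B t)).prod.trace = 0 := by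
    have h := hT.map_star_trace_ofFn_mul_of_ne hφ hN (s := Fin.elim0) (A := Fin.elim0)
      (p := Fin.elim0) (n := 0) ⟨fun t h => absurd h (by omega), fun t => t.elim0⟩ hjB hm hm.ne
      (fun t => t.elim0) hQmem
    have hN' : (N : ℂ) ≠ 0 := by exact_mod_cast hN.ne'
    rw [List.ofFn_zero, List.prod_nil, Matrix.trace_one, Fintype.card_fin, star_natCast,
      ← nsmul_eq_mul, map_nsmul, nsmul_eq_mul] at h
    exact (mul_eq_zero.1 h).resolve_left hN'
  rw [freeCumulant_two, hQ0, mul_zero, sub_zero, hY]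
  split_ifs with h
  · subst h
    rw [hT.map_star_trace_ofFn_mul hφ hN hsA hjB hn hPmem hQmem]
    simp only [Matrix.conjTranspose_conjTranspose, hPstar, Fin.cast_refl, id]
  · exact hT.map_star_trace_ofFn_mul_of_ne hφ hN hsA hjB hm h hPmem hQmem
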